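/- Let $m\ge 2$, $n=2^m-1$, let $h_2\in\mathbb Z_2[X]$ be a primitive irreducible polynomial of degree $m$ (irreducible, with a root of multiplicative order $2^m-1$), and let $h\in\mathbb Z_4[X]$ be the monic polynomial of degree $m$ with $h\equiv h_2 \pmod 2$ and $h\mid X^n-1$ in $\mathbb Z_4[X]$. Let $g$ be the reciprocal polynomial of $(X^n-1)/((X-1)h(X))$. Let $D\subseteq\mathbb Z_4^{2^m}$ be the cyclic code of length $n$ over $\mathbb Z_4$ generated by $g$ (the ideal of $\mathbb Z_4[X]/(X^n-1)$ generated by $g$), extended by an overall parity check (a last coordinate making the sum of all coordinates $0$ modulo $4$). Then the cyclic code of length $n$ generated by $h$, extended by an overall parity check, is the dual $D^\perp=\{a\in\mathbb Z_4^{2^m} : a\cdot b=0 \text{ for all } b\in D\}$, where $a\cdot b=\sum_i a_ib_i \pmod 4$. Suppose moreover that $m\ge 3$ is odd. Let $\phi:\mathbb Z_4^{N}\to\mathbb Z_2^{2N}$ be the Gray map $\phi(a)=(\beta(a),\gamma(a))$, applied componentwise, where $\beta$ sends $0,1,2,3$ to $0,0,1,1$ and $\gamma$ sends $0,1,2,3$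 to $0,1,1,0$. Put $K=\phi(D)$ and $P=\phi(D^\perp)$. Then $P$ has length $2^{m+1}$, contains $2^{k}$ words with $k=2^{m+1}-2m-2$, and has minimal distance $6$; $P$ and $K$ are distance invariant. Write $W_C(x,y)=\sum_{u\in C}x^{N-\mathrm{wt}(u)}y^{\mathrm{wt}(u)}$ for the Hamming weight enumerator of a binary code $C$ of length $N$. Then: (i) $W_P$ equals the weight enumerator of the Preparata code of length $2^{m+1}$, that is, of the code of all pairs $(S,T)$ of subsets of the field $F$ of order $2^m$ (identified with their indicator vectors in $\mathbb Z_2^{F}\times\mathbb Z_2^F$) such that $|S|$ and $|T|$ are even, $\sum_{x\in S}x=\sum_{y\in T}y$ and $\sum_{x\in S}x^3+\bigl(\sum_{x\in S}x\bigr)^3=\sum_{y\in T}y^3$; (ii) $W_P$ is the MacWilliams transform of the Kerdock weight enumerator: $W_P(x,y)=\frac1{|K|}W_K(x+y,x-y)$, and also $W_P(x,y)=\frac1{4^{m+1}}W(x+y,x-y)$, where $$W(x,y)=x^{2^{m+1}}+2^{m+1}(2^m-1)\bigl(x^{b}y^{a}+x^{a}y^{b}\bigr)+(2^{m+2}-2)x^{2^m}y^{2^m}+y^{2^{m+1}},\qquad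 a=2^m-2^{(m-1)/2},\ b=2^m+2^{(m-1)/2},$$ is the weight enumerator of the Kerdock code of length $2^{m+1}$. -/

import Mathlib

open Polynomial

namespace Z4Code

/-! ### Quaternary linear codes, duality, and the Gray map -/

/-- The dual of a quaternary linear code (an additive subgroup of `ℤ₄ⁿ`) with respect to
`a · b = ∑ aᵢ bᵢ (mod 4)`. -/
def dual {ι : Type*} [Fintype ι] (D : AddSubgroup (ι → ZMod 4)) :
    AddSubgroup (ι → ZMod 4) where
  carrier := {a | ∀ b ∈ D, ∑ i, a i * b i = 0}
  zero_mem' := by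
    intro b _
    simp
  add_mem' := by
    intro a a' ha ha' b hb
    have h1 := ha b hb
    have h2 := ha' b hb
    simp [add_mul, Finset.sum_add_distrib, h1, h2]
  neg_mem' := by
    intro a ha b hb
    have h1 := ha b hb
    simp [h1]

/-- The map `β : 0, 1, 2, 3 ↦ 0, 0, 1, 1`. -/
def β (i : ZMod 4) : ZMod 2 := if i = 2 ∨ i = 3 then 1 else 0

/-- The map `γ : 0, 1, 2, 3 ↦ 0, 1, 1, 0`. -/
def γ (i : ZMod 4) : ZMod 2 := if i = 1 ∨ i = 2 then 1 else 0

/-- The Gray map `φ(a) = (β(a), γ(a))` from `ℤ₄ᴺ` to `ℤ₂²ᴺ`. -/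
def gray {N : ℕ} (a : Fin N → ZMod 4) : Fin (N + N) → ZMod 2 :=
  Fin.append (fun i => β (a i)) (fun i => γ (a i))

/-- The binary code `φ(D)` of a quaternary linear code `D`. -/
def binaryImage {N : ℕ} (D : AddSubgroup (Fin N → ZMod 4)) : Set (Fin (N + N) → ZMod 2) :=
  gray '' (D : Set (Fin N → ZMod 4))

/-! ### Cyclic codes and their extension by an overall parity check -/

/-- The polynomial `c₀ + c₁ X + ⋯ + cₙ₋₁ Xⁿ⁻¹` of the vector `c`. -/
noncomputable def toPoly {n : ℕ} (c : Fin n → ZMod 4) : (ZMod 4)[X] :=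
  ∑ i, C (c i) * X ^ (i : ℕ)

/-- The quaternary cyclic code of length `n` generated by `p`: the vectors whose polynomial lies,
modulo `Xⁿ - 1`, in the ideal of `ℤ₄[X] / (Xⁿ - 1)` generated by `p`. -/
noncomputable def cyclicCode (n : ℕ) (p : (ZMod 4)[X]) : AddSubgroup (Fin n → ZMod 4) where
  carrier := {c | toPoly c ∈ Ideal.span {p, X ^ n - 1}}
  zero_mem' := by simp [toPoly]
  add_mem' := by
    intro a b ha hb
    have h : toPoly (a + b) = toPoly a + toPoly b := by
      simp [toPoly, add_mul, Finset.sum_add_distrib]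
    rw [Set.mem_ofPred_eq, h]
    exact Ideal.add_mem _ ha hb
  neg_mem' := by
    intro a ha
    have h : toPoly (-a) = -toPoly a := by simp [toPoly]
    rw [Set.mem_ofPred_eq, h]
    exact neg_mem ha

/-- The extension of a quaternary code by an overall parity check: the words
`(c₀, …, cₙ₋₁, c_∞)` with `(c₀, …, cₙ₋₁)` in the code and `c₀ + ⋯ + cₙ₋₁ + c_∞ = 0`. -/
def extend {n : ℕ} (D : AddSubgroup (Fin n → ZMod 4)) : AddSubgroup (Fin (n + 1) → ZMod 4) where
  carrier := {v | (fun i : Fin n => v i.castSucc) ∈ D ∧ ∑ i, v i = 0}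
  zero_mem' := ⟨D.zero_mem, by simp⟩
  add_mem' := by
    intro a b ha hb
    exact ⟨D.add_mem ha.1 hb.1, by simp [Finset.sum_add_distrib, ha.2, hb.2]⟩
  neg_mem' := by
    intro a ha
    exact ⟨D.neg_mem ha.1, by simp [ha.2]⟩

/-! ### The polynomials `h₂`, `h` and `g` -/

/-- `h₂` is a primitive irreducible binary polynomial of degree `m`: it is irreducible of degree
`m`, and its root `X mod h₂` in the field `ℤ₂[X] / (h₂)` of order `2ᵐ` has multiplicative order
`2ᵐ - 1`. -/
def IsPrimitiveIrreducible (m : ℕ) (h₂ : (ZMod 2)[X]) : Prop :=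
  Irreducible h₂ ∧ h₂.natDegree = m ∧ orderOf (AdjoinRoot.root h₂) = 2 ^ m - 1

/-- `h` is the monic polynomial of degree `m` over `ℤ₄` with `h ≡ h₂ (mod 2)` that divides
`X ^ (2ᵐ - 1) - 1`. -/
def IsLift (m : ℕ) (h₂ : (ZMod 2)[X]) (h : (ZMod 4)[X]) : Prop :=
  h.Monic ∧ h.natDegree = m ∧ h.map (ZMod.castHom (by norm_num : 2 ∣ 4) (ZMod 2)) = h₂ ∧
    h ∣ X ^ (2 ^ m - 1) - 1

/-- The polynomial `g`, the reciprocal of `(Xⁿ - 1) / ((X - 1) h(X))` where `n = 2ᵐ - 1`. -/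
noncomputable def dualGenerator (m : ℕ) (h : (ZMod 4)[X]) : (ZMod 4)[X] :=
  ((X ^ (2 ^ m - 1) - 1) /ₘ ((X - 1) * h)).reverse

/-- The quaternary code `D`: the cyclic code generated by `g`, with an overall parity check. -/
noncomputable def codeD (m : ℕ) (h : (ZMod 4)[X]) :
    AddSubgroup (Fin (2 ^ m - 1 + 1) → ZMod 4) :=
  extend (cyclicCode (2 ^ m - 1) (dualGenerator m h))

/-- The cyclic code generated by `h`, with an overall parity check. -/
noncomputable def codeH (m : ℕ) (h : (ZMod 4)[X]) :
    AddSubgroup (Fin (2 ^ m - 1 + 1) → ZMod 4) :=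
  extend (cyclicCode (2 ^ m - 1) h)

/-! ### Parameters of binary codes -/

/-- The length of a code. -/
def length {ι α : Type*} [Fintype ι] (_ : Set (ι → α)) : ℕ := Fintype.card ι

/-- `d` is the minimal distance of the code `P`. -/
def HasMinDistance {ι : Type*} [Fintype ι] (P : Set (ι → ZMod 2)) (d : ℕ) : Prop :=
  IsLeast {e | ∃ u ∈ P, ∃ v ∈ P, u ≠ v ∧ hammingDist u v = e} d

/-- A code is distance invariant if the number of codewords at each distance from a given codeword
does not depend on that codeword. -/
def DistanceInvariant {ι : Type*} [Fintype ι] (P : Set (ι → ZMod 2)) : Prop :=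
  ∀ u ∈ P, ∀ v ∈ P, ∀ d : ℕ,
    {w ∈ P | hammingDist u w = d}.ncard = {w ∈ P | hammingDist v w = d}.ncard

/-- The Hamming weight enumerator `W(x, y) = ∑ x ^ (N - wt u) y ^ (wt u)`, the sum being over all
codewords `u`, where `N` is the length; the variables `x`, `y` have index `0`, `1`. -/
noncomputable def weightEnumerator {ι : Type*} [Fintype ι] (P : Set (ι → ZMod 2)) :
    MvPolynomial (Fin 2) ℚ :=
  ∑ u ∈ P.toFinite.toFinset,
    MvPolynomial.X 0 ^ (Fintype.card ι - hammingNorm u) * MvPolynomial.X 1 ^ hammingNorm u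

/-- The MacWilliams transform `M⁻¹ W(x + y, x - y)` of the weight enumerator `W(x, y)` of a code
with `M` words. -/
noncomputable def macWilliams (M : ℕ) (W : MvPolynomial (Fin 2) ℚ) : MvPolynomial (Fin 2) ℚ :=
  MvPolynomial.C (1 / (M : ℚ)) *
    MvPolynomial.aeval
      ![MvPolynomial.X 0 + MvPolynomial.X 1, MvPolynomial.X 0 - MvPolynomial.X 1] W

/-! ### The classical Kerdock weight enumerator and the classical Preparata code -/

/-- The weight enumerator of the Kerdock code of length `2 ^ (m + 1)`, `m` odd. -/
noncomputable def kerdockEnumerator (m : ℕ) : MvPolynomial (Fin 2) ℚ :=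
  let x : MvPolynomial (Fin 2) ℚ := MvPolynomial.X 0
  let y : MvPolynomial (Fin 2) ℚ := MvPolynomial.X 1
  let a : ℕ := 2 ^ m - 2 ^ ((m - 1) / 2)
  let b : ℕ := 2 ^ m + 2 ^ ((m - 1) / 2)
  x ^ 2 ^ (m + 1)
    + MvPolynomial.C (2 ^ (m + 1) * (2 ^ m - 1)) * (x ^ b * y ^ a)
    + MvPolynomial.C (2 ^ (m + 2) - 2) * (x ^ 2 ^ m * y ^ 2 ^ m)
    + MvPolynomial.C (2 ^ (m + 1) * (2 ^ m - 1)) * (x ^ a * y ^ b)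
    + y ^ 2 ^ (m + 1)

/-- The (extended) Preparata code of length `2 ^ (m + 1)`, `m` odd, in the description of Baker,
van Lint and Wilson.  The coordinates are two copies of the field `F` of order `2 ^ m`; a word is
the indicator of a pair `(S, T)` of subsets of `F`, and it is a codeword if `|S|` and `|T|` are
even, `∑_S x = ∑_T y`, and `∑_S x³ + (∑_S x)³ = ∑_T y³`. -/
def preparataCode (F : Type*) [Field F] [Fintype F] : Set (F ⊕ F → ZMod 2) :=
  {u |
    let S : Finset F := {x | u (Sum.inl x) = 1}
    let T : Finset F := {y | u (Sum.inr y) = 1}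
    Even S.card ∧ Even T.card ∧
      ∑ x ∈ S, x = ∑ y ∈ T, y ∧
      ∑ x ∈ S, x ^ 3 + (∑ x ∈ S, x) ^ 3 = ∑ y ∈ T, y ^ 3}

end Z4Code

namespace Z4Code

/-! ### The Gray map -/

/-! Let `R = ℤ₄[X]/(h)`, a Galois ring whose residue field has `q = 2ᵐ` elements, with root `ξ` and
Teichmüller set `{0, 1, ξ, …, ξⁿ⁻¹}`. The words `(ε + l(t))ₜ`, with `l : R → ℤ₄` linear and `t` in
this set, lie in `D`; there are `4ᵐ⁺¹` of them, and a degree bound shows that `D` has no more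
(`range_functionalWord`). A word `v` lies in the extended code of `h` iff `∑ vₜ t = 0` and `∑ vₜ =
0`, which says exactly that it is orthogonal to all words `ε + l(t)`; hence the duality.

The Gray map is an isometry from Lee to Hamming distance, so images of linear codes are distance
invariant. Poisson summation with `z ↦ iᶻ` gives the binary MacWilliams identity for the images of a
code and its dual.

The word of `(l, ε)` has Gray weight `2ᵐ - Re(i^ε S)`, where `S = ∑ₜ i^{l(t)}`. Differences of
distinct Teichmüller elements meet each element outside `2R` exactly once, so `|S|² = 2ᵐ` if `2l ≠
0`; and `S = 0` if `2l = 0`, `l ≠ 0`. For `m = 2k + 1` the equation `a² + b² = 2·4ᵏ` forces `a, b =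
±2ᵏ`, so `K` has the Kerdock enumerator. The size and minimal distance of `P` are read off its
transform.

The Preparata code is not linear, so its indicator function is expanded in characters of `F`. The
Fourier coefficients are cubic sums `G(a + b, c)`, and the twisted factors depend only on `±G(a, c)
± G(b, c)`. Whenever `c ≠ 0` and `G(a + b, c) ≠ 0`, this quantity is `±2·2ᵏ`
(`cubicSum_trichotomy`), and the sum collapses to the same transform of the Kerdock enumerator. -/

/-- The Lee weight on `ℤ₄`. -/
def lee (z : ZMod 4) : ℕ := (if β z ≠ 0 then 1 else 0) + (if γ z ≠ 0 then 1 else 0)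

lemma lee_le_two (z : ZMod 4) : lee z ≤ 2 := by revert z; decide

lemma hammingNorm_gray {N : ℕ} (a : Fin N → ZMod 4) :
    hammingNorm (gray a) = ∑ i, lee (a i) := by
  rw [hammingNorm, Finset.card_filter, Fin.sum_univ_add]
  simp only [gray, Fin.append_left, Fin.append_right, lee, Finset.sum_add_distrib]

/-- The Gray map is not additive, yet distances depend only on differences; this is a finite check
in each coordinate. -/
lemma hammingDist_gray {N : ℕ} (a b : Fin N → ZMod 4) :
    hammingDist (gray a) (gray b) = hammingNorm (gray (a - b)) := by
  have key : ∀ x y : ZMod 4, (if β x ≠ β y then 1 else 0) + (if γ x ≠ γ y then 1 else 0)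
      = lee (x - y) := by decide
  rw [hammingNorm_gray, hammingDist, Finset.card_filter, Fin.sum_univ_add]
  simp only [gray, Fin.append_left, Fin.append_right, ← Finset.sum_add_distrib, key, Pi.sub_apply]

lemma gray_injective {N : ℕ} : Function.Injective (gray (N := N)) := by
  intro a b hab
  have h0 : hammingNorm (gray (a - b)) = 0 := by rw [← hammingDist_gray, hab, hammingDist_self]
  rw [hammingNorm_gray, Finset.sum_eq_zero_iff] at h0
  have key : ∀ z : ZMod 4, lee z = 0 → z = 0 := by decide
  funext i
  exact sub_eq_zero.mp (key _ (h0 i (Finset.mem_univ i)))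

/-- The map `c ↦ φ(a - c)` carries the words of weight `d` to the words at distance `d` from `φ(a)`,
for every `a` in `D`. -/
theorem distanceInvariant_binaryImage {N : ℕ} (D : AddSubgroup (Fin N → ZMod 4)) :
    DistanceInvariant (binaryImage D) := by
  have key : ∀ a ∈ D, ∀ d : ℕ, {w ∈ binaryImage D | hammingDist (gray a) w = d}.ncard =
      {c | c ∈ D ∧ hammingNorm (gray c) = d}.ncard := by
    intro a ha d
    have : {w ∈ binaryImage D | hammingDist (gray a) w = d} =
        (fun c => gray (a - c)) '' {c | c ∈ D ∧ hammingNorm (gray c) = d} := by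
      ext w
      constructor
      · rintro ⟨⟨b, hb, rfl⟩, h⟩
        refine ⟨a - b, ⟨D.sub_mem ha hb, by rw [← hammingDist_gray, h]⟩, by simp⟩
      · rintro ⟨c, ⟨hc, h⟩, rfl⟩
        exact ⟨⟨a - c, D.sub_mem ha hc, rfl⟩, by rw [hammingDist_gray, sub_sub_cancel, h]⟩
    rw [this]
    refine Set.ncard_image_of_injective _ fun b c hbc => ?_
    exact sub_right_injective (gray_injective hbc)
  rintro _ ⟨a, ha, rfl⟩ _ ⟨b, hb, rfl⟩ d
  rw [key a ha, key b hb]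

lemma ncard_binaryImage {N : ℕ} (D : AddSubgroup (Fin N → ZMod 4)) :
    (binaryImage D).ncard = Nat.card D := by
  rw [binaryImage, Set.ncard_image_of_injective _ gray_injective,
    ← Nat.card_coe_set_eq]
  rfl

open Classical in
lemma weightEnumerator_binaryImage {N : ℕ} (D : AddSubgroup (Fin N → ZMod 4)) :
    weightEnumerator (binaryImage D) = ∑ c with c ∈ D,
      MvPolynomial.X 0 ^ (N + N - hammingNorm (gray c)) *
        MvPolynomial.X 1 ^ hammingNorm (gray c) := by
  rw [weightEnumerator, Fintype.card_fin]
  symm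
  refine Finset.sum_bij (fun c _ => gray c) ?_ ?_ ?_ ?_
  · intro c hc
    exact (Set.Finite.mem_toFinset _).mpr ⟨c, (Finset.mem_filter.mp hc).2, rfl⟩
  · intro c _ d _ h
    exact gray_injective h
  · intro u hu
    obtain ⟨c, hc, rfl⟩ := (Set.Finite.mem_toFinset _).mp hu
    exact ⟨c, Finset.mem_filter.mpr ⟨Finset.mem_univ _, hc⟩, rfl⟩
  · intros; rfl

/-- The monomial of a word factors over its coordinates, which is the form that Poisson summation
needs. -/
lemma pow_mul_pow_hammingNorm_gray {A : Type*} [CommRing A] {N : ℕ} (x y : A)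
    (a : Fin N → ZMod 4) :
    x ^ (N + N - hammingNorm (gray a)) * y ^ hammingNorm (gray a) =
      ∏ i, x ^ (2 - lee (a i)) * y ^ lee (a i) := by
  have h : N + N - hammingNorm (gray a) = ∑ i, (2 - lee (a i)) := by
    have : ∑ i, (2 - lee (a i)) + ∑ i, lee (a i) = N + N := by
      rw [← Finset.sum_add_distrib, Finset.sum_congr rfl fun i _ =>
        Nat.sub_add_cancel (lee_le_two (a i))]
      simp [mul_two]
    rw [hammingNorm_gray]; omega
  rw [h, hammingNorm_gray, Finset.prod_mul_distrib, Finset.prod_pow_eq_pow_sum,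
    Finset.prod_pow_eq_pow_sum]

/-! ### The MacWilliams identity for the Gray image of a dual code -/

-- The map `d ↦ ψ(d · c)` is a character of `D`; as `ψ` is faithful, it is trivial exactly for `c`
-- in the dual.
open Classical in
lemma sum_addChar_dual {ι : Type*} [Fintype ι] (ψ : AddChar (ZMod 4) ℂ)
    (hψ : ∀ z, ψ z = 1 → z = 0) (D : AddSubgroup (ι → ZMod 4)) (c : ι → ZMod 4) :
    ∑ d : D, ψ (∑ i, (d : ι → ZMod 4) i * c i) =
      if c ∈ dual D then (Nat.card D : ℂ) else 0 := by
  let χ : AddChar D ℂ :=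
    { toFun := fun d => ψ (∑ i, (d : ι → ZMod 4) i * c i)
      map_zero_eq_one' := by simp
      map_add_eq_mul' := fun a b => by
        simp [add_mul, Finset.sum_add_distrib, AddChar.map_add_eq_mul] }
  have hχ : (∑ d : D, ψ (∑ i, (d : ι → ZMod 4) i * c i)) = ∑ d, χ d := rfl
  have h1 : χ = 0 ↔ c ∈ dual D := by
    rw [AddChar.eq_zero_iff]
    constructor
    · intro h b hb
      have := hψ _ (h ⟨b, hb⟩)
      simpa [mul_comm] using this
    · intro h d
      have := h d d.2
      change ψ _ = 1
      simp_rw [mul_comm _ (c _)]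
      rw [this, AddChar.map_zero_eq_one]
  rw [hχ, AddChar.sum_eq_ite]
  simp only [h1, Nat.card_eq_fintype_card]

open Classical in
lemma poisson_dual {ι : Type*} [Fintype ι] (ψ : AddChar (ZMod 4) ℂ)
    (hψ : ∀ z, ψ z = 1 → z = 0) (D : AddSubgroup (ι → ZMod 4)) (f : ZMod 4 → ℂ) :
    ∑ d with d ∈ D, ∏ i, ∑ z, ψ (d i * z) * f z =
      (Nat.card D : ℂ) * ∑ c with c ∈ dual D, ∏ i, f (c i) := by
  have h1 : ∀ d : ι → ZMod 4, ∏ i, ∑ z, ψ (d i * z) * f z =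
      ∑ c : ι → ZMod 4, ψ (∑ i, d i * c i) * ∏ i, f (c i) := by
    intro d
    rw [Finset.prod_univ_sum, Fintype.piFinset_univ]
    refine Finset.sum_congr rfl fun c _ => ?_
    rw [Finset.prod_mul_distrib]
    congr 1
    exact (map_prod ψ.toMonoidHom (fun i => Multiplicative.ofAdd (d i * c i)) Finset.univ).symm
  have h2 : ∀ c : ι → ZMod 4,
      ∑ d with d ∈ D, ψ (∑ i, d i * c i) * ∏ i, f (c i) =
        if c ∈ dual D then (Nat.card D : ℂ) * ∏ i, f (c i) else 0 := by
    intro c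
    rw [← Finset.sum_mul, Finset.sum_subtype (p := fun d => d ∈ D) _ (fun x => by simp),
      sum_addChar_dual ψ hψ D, ite_mul, zero_mul]
  rw [Finset.sum_congr rfl fun d _ => h1 d, Finset.sum_comm, Finset.sum_congr rfl fun c _ => h2 c,
    ← Finset.sum_filter, Finset.mul_sum]

lemma eval_macWilliams (M : ℕ) (W : MvPolynomial (Fin 2) ℚ) (v : Fin 2 → ℚ) :
    MvPolynomial.eval v (macWilliams M W) =
      1 / (M : ℚ) * MvPolynomial.eval ![v 0 + v 1, v 0 - v 1] W := by
  rw [macWilliams, map_mul, MvPolynomial.eval_C, MvPolynomial.aeval_def,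
    ← MvPolynomial.coe_eval₂Hom, ← RingHom.comp_apply]
  congr 2
  apply MvPolynomial.ringHom_ext
  · intro r; simp
  · intro i; fin_cases i <;> simp

/-- The character `z ↦ iᶻ` of `ℤ₄`. -/
noncomputable def quarticChar : AddChar (ZMod 4) ℂ :=
  AddChar.zmodChar 4 (by simp : Complex.I ^ 4 = 1)

lemma quarticChar_eq_one (z : ZMod 4) (h : quarticChar z = 1) : z = 0 := by
  rw [quarticChar, AddChar.zmodChar_apply] at h
  by_contra hz
  have h3 : z.val = 1 ∨ z.val = 2 ∨ z.val = 3 := by clear h; revert z; decide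
  rcases h3 with h3 | h3 | h3 <;> rw [h3] at h
  · simpa using congrArg Complex.im h
  · norm_num [Complex.I_sq] at h
  · rw [Complex.I_pow_three] at h
    simpa using congrArg Complex.im h

/-- The Fourier transform of the Lee weight on `ℤ₄` is the binary substitution `(x + y, x - y)`.
This is why duality over `ℤ₄` becomes the MacWilliams identity after the Gray map. -/
lemma sum_quarticChar_lee (x y : ℂ) (w : ZMod 4) :
    ∑ z, quarticChar (w * z) * (x ^ (2 - lee z) * y ^ lee z) =
      (x + y) ^ (2 - lee w) * (x - y) ^ lee w := by
  have hu : (Finset.univ : Finset (ZMod 4)) = {0, 1, 2, 3} := by decide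
  have e0 : quarticChar 0 = 1 := AddChar.map_zero_eq_one _
  have e1 : quarticChar 1 = Complex.I := by
    rw [quarticChar, AddChar.zmodChar_apply]
    exact pow_one _
  have e2 : quarticChar 2 = -1 := by
    rw [quarticChar, AddChar.zmodChar_apply]
    exact Complex.I_sq
  have e3 : quarticChar 3 = -Complex.I := by
    rw [quarticChar, AddChar.zmodChar_apply]
    exact Complex.I_pow_three
  have l0 : lee 0 = 0 := by decide
  have l1 : lee 1 = 1 := by decide
  have l2 : lee 2 = 2 := by decide
  have l3 : lee 3 = 1 := by decide
  have m1 : (2 * 2 : ZMod 4) = 0 := by decide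
  have m2 : (2 * 3 : ZMod 4) = 2 := by decide
  have m3 : (3 * 2 : ZMod 4) = 2 := by decide
  have m4 : (3 * 3 : ZMod 4) = 1 := by decide
  have hw : w = 0 ∨ w = 1 ∨ w = 2 ∨ w = 3 := by revert w; decide
  rw [hu, Finset.sum_insert (by decide), Finset.sum_insert (by decide),
    Finset.sum_insert (by decide), Finset.sum_singleton]
  rcases hw with rfl | rfl | rfl | rfl <;>
    simp only [zero_mul, mul_zero, one_mul, mul_one, m1, m2, m3, m4, e0, e1, e2, e3, l0, l1, l2,
      l3] <;> ring

open Classical in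
theorem weightEnumerator_binaryImage_dual {N : ℕ} (D : AddSubgroup (Fin N → ZMod 4)) :
    weightEnumerator (binaryImage (dual D)) =
      macWilliams (binaryImage D).ncard (weightEnumerator (binaryImage D)) := by
  apply MvPolynomial.funext
  intro v
  rw [eval_macWilliams, ncard_binaryImage, weightEnumerator_binaryImage,
    weightEnumerator_binaryImage]
  simp only [map_sum, map_mul, map_pow, MvPolynomial.eval_X, Matrix.cons_val_zero,
    Matrix.cons_val_one]
  have hD : (Nat.card D : ℚ) ≠ 0 := by simp
  rw [one_div, eq_inv_mul_iff_mul_eq₀ hD]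
  simp_rw [pow_mul_pow_hammingNorm_gray]
  have h := (poisson_dual quarticChar quarticChar_eq_one D
    (fun z => (v 0 : ℂ) ^ (2 - lee z) * (v 1 : ℂ) ^ lee z)).symm
  simp only [sum_quarticChar_lee] at h
  apply Rat.cast_injective (α := ℂ)
  rw [Rat.cast_mul, Rat.cast_natCast, Rat.cast_sum, Rat.cast_sum]
  simp only [Rat.cast_prod, Rat.cast_mul, Rat.cast_pow, Rat.cast_add, Rat.cast_sub]
  convert h

/-! ### Teichmüller representatives in a Galois ring of characteristic `4` -/

/-- `t` enumerates the Teichmüller representatives of a ring `R` of characteristic `4` whose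
reduction modulo `2` is the field `F`. -/
structure IsTeichmuller {R F ι : Type*} [CommRing R] [Field F] (π : R →+* F) (t : ι → R) :
    Prop where
  four_eq_zero : (4 : R) = 0
  two_mul_eq_zero : ∀ a, 2 * a = 0 ↔ π a = 0
  exists_eq_two_mul : ∀ a, π a = 0 → ∃ b, a = 2 * b
  bijective : Function.Bijective fun i => π (t i)
  exists_sq : ∀ i, ∃ p, p ^ 2 = t i

namespace IsTeichmuller

variable {R F ι : Type*} [CommRing R] [Field F] {π : R →+* F} {t : ι → R}

lemma map_two (h : IsTeichmuller π t) : (2 : F) = 0 := by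
  rw [← map_ofNat π 2, ← h.two_mul_eq_zero]
  linear_combination h.four_eq_zero

lemma map_two_mul (h : IsTeichmuller π t) (x : R) : π (2 * x) = 0 := by
  rw [map_mul, map_ofNat, h.map_two, zero_mul]

/-- Squaring forgets multiples of `2`: `(b + 2k)² = b² + 4(bk + k²)`. -/
lemma sq_eq_sq (h : IsTeichmuller π t) {a b : R} (hab : π a = π b) : a ^ 2 = b ^ 2 := by
  obtain ⟨k, hk⟩ := h.exists_eq_two_mul (a - b) (by rw [map_sub, hab, sub_self])
  rw [eq_add_of_sub_eq hk]
  linear_combination (k ^ 2 + k * b) * h.four_eq_zero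

/-- A Sidon property. Take square roots `p, q, r, s` of the four representatives. Modulo `2` they
satisfy `p + q = r + s`, so `(p + q)² = (r + s)²` in `R`; subtracting the hypothesis leaves `2pq =
2rs`. The pairs thus have equal sum and product in the field, hence agree up to order. -/
lemma add_eq_add (h : IsTeichmuller π t) {i j k l : ι} (hs : t i + t j = t k + t l) :
    (i = k ∧ j = l) ∨ (i = l ∧ j = k) := by
  obtain ⟨p, hp⟩ := h.exists_sq i
  obtain ⟨q, hq⟩ := h.exists_sq j
  obtain ⟨r, hr⟩ := h.exists_sq k
  obtain ⟨s, hs'⟩ := h.exists_sq l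
  have e : p ^ 2 + q ^ 2 = r ^ 2 + s ^ 2 := by rw [hp, hq, hr, hs', hs]
  have e1 : π p + π q = π r + π s := by
    have := congrArg π e
    simp only [map_add, map_pow] at this
    refine sub_eq_zero.mp (pow_eq_zero_iff two_ne_zero |>.mp ?_)
    linear_combination this + (π p * π q + π r * π s - (π p + π q) * (π r + π s) + π r ^ 2
      + π s ^ 2) * h.map_two
  have e2 : (p + q) ^ 2 = (r + s) ^ 2 := h.sq_eq_sq (by simpa using e1)
  have e3 : π p * π q = π r * π s := by
    rw [← sub_eq_zero, ← map_mul, ← map_mul, ← map_sub, ← h.two_mul_eq_zero]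
    linear_combination e2 - e
  have e4 : (π p - π r) * (π p - π s) = 0 := by linear_combination π p * e1 - e3
  have inj : ∀ {x y : R} {a b : ι}, x ^ 2 = t a → y ^ 2 = t b → π x = π y → a = b := by
    intro x y a b hx hy hxy
    apply h.bijective.1
    simp only [← hx, ← hy, map_pow, hxy]
  rcases mul_eq_zero.mp e4 with h0 | h0
  · have h1 := sub_eq_zero.mp h0
    exact Or.inl ⟨inj hp hr h1, inj hq hs' (by linear_combination e1 - h1)⟩
  · have h1 := sub_eq_zero.mp h0
    exact Or.inr ⟨inj hp hs' h1, inj hq hr (by linear_combination e1 - h1)⟩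

lemma bijective_two_digits (h : IsTeichmuller π t) :
    Function.Bijective fun ij : ι × ι => t ij.1 + 2 * t ij.2 := by
  constructor
  · rintro ⟨i, j⟩ ⟨k, l⟩ he
    have hik : i = k := by
      apply h.bijective.1
      have := congrArg π he
      simpa only [map_add, h.map_two_mul, add_zero] using this
    subst hik
    have hjl : j = l := by
      apply h.bijective.1
      have := add_left_cancel he
      rw [← sub_eq_zero, ← mul_sub, h.two_mul_eq_zero, map_sub, sub_eq_zero] at this
      exact this
    rw [hjl]
  · intro u
    obtain ⟨i, hi⟩ := h.bijective.2 (π u)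
    obtain ⟨b, hb⟩ := h.exists_eq_two_mul (u - t i) (by rw [map_sub, sub_eq_zero]; exact hi.symm)
    obtain ⟨j, hj⟩ := h.bijective.2 (π b)
    refine ⟨(i, j), ?_⟩
    have : 2 * (b - t j) = 0 := by
      rw [h.two_mul_eq_zero, map_sub, sub_eq_zero]; exact hj.symm
    change t i + 2 * t j = u
    linear_combination -hb - this

open Classical in
lemma injOn_sub [Fintype ι] (h : IsTeichmuller π t) : Set.InjOn (fun ij : ι × ι => t ij.1 - t ij.2)
    ((Finset.univ : Finset ι).offDiag : Finset (ι × ι)) := by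
  rintro ⟨i, j⟩ hij ⟨k, l⟩ hkl he
  have hne := (Finset.mem_offDiag.mp (Finset.mem_coe.mp hij)).2.2
  have he' : t i + t l = t k + t j := by
    have : t i - t j = t k - t l := he
    linear_combination this
  rcases h.add_eq_add he' with ⟨h1, h2⟩ | ⟨h1, h2⟩
  · rw [h1, h2]
  · exact absurd h1 hne

variable [Fintype R] [Fintype ι]

lemma card_eq (h : IsTeichmuller π t) : Fintype.card R = Fintype.card ι * Fintype.card ι := by
  rw [← Fintype.card_prod]
  exact (Fintype.card_of_bijective h.bijective_two_digits).symm

open Classical in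
lemma card_map_eq_zero (h : IsTeichmuller π t) :
    Finset.card {u : R | π u = 0} = Fintype.card ι := by
  rw [← Finset.card_univ]
  symm
  refine Finset.card_bij (fun i _ => 2 * t i) ?_ ?_ ?_
  · intro i _
    simp [h.map_two_mul, -map_mul]
  · intro i _ j _ hij
    apply h.bijective.1
    rw [← sub_eq_zero, ← mul_sub, h.two_mul_eq_zero, map_sub, sub_eq_zero] at hij
    exact hij
  · intro u hu
    obtain ⟨b, rfl⟩ := h.exists_eq_two_mul u (Finset.mem_filter.mp hu).2
    obtain ⟨j, hj⟩ := h.bijective.2 (π b)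
    refine ⟨j, Finset.mem_univ _, ?_⟩
    rw [← sub_eq_zero, ← mul_sub, h.two_mul_eq_zero, map_sub, sub_eq_zero]
    exact hj

-- By the Sidon property the `q(q - 1)` differences are distinct, and `q² - q` elements lie outside
-- the kernel of `π`.
open Classical in
lemma image_offDiag (h : IsTeichmuller π t) :
    (Finset.univ : Finset ι).offDiag.image (fun ij => t ij.1 - t ij.2) =
      ({u : R | π u ≠ 0} : Finset R) := by
  apply Finset.eq_of_subset_of_card_le
  · intro u hu
    obtain ⟨⟨i, j⟩, hij, rfl⟩ := Finset.mem_image.mp hu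
    rw [Finset.mem_filter]
    refine ⟨Finset.mem_univ _, fun h0 => (Finset.mem_offDiag.mp hij).2.2 ?_⟩
    rw [map_sub, sub_eq_zero] at h0
    exact h.bijective.1 h0
  · rw [Finset.card_image_of_injOn h.injOn_sub, Finset.offDiag_card, Finset.card_univ]
    have := Finset.card_filter_add_card_filter_not (s := (Finset.univ : Finset R))
      (fun u => π u = 0)
    rw [h.card_map_eq_zero, Finset.card_univ, h.card_eq] at this
    exact (Nat.sub_eq_of_eq_add' this.symm).ge

/-- The diagonal of the double sum contributes the number of representatives. The rest is the sum of
`ψ` outside the kernel of `π`, a set stable under translation by `2b`; since `ψ(2b) ≠ 1`, that sum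
is zero. -/
lemma sum_sub_eq (h : IsTeichmuller π t) {A : Type*} [CommRing A] [IsDomain A]
    (ψ : AddChar R A) {b : R} (hb : ψ (2 * b) ≠ 1) :
    (∑ i, ψ (t i)) * ∑ j, ψ (-t j) = Fintype.card ι := by
  classical
  have h0 : ∑ u with π u ≠ 0, ψ u = 0 := by
    have h1 : ψ (2 * b) * ∑ u with π u ≠ 0, ψ u = ∑ u with π u ≠ 0, ψ u := by
      rw [Finset.mul_sum]
      simp_rw [← AddChar.map_add_eq_mul]
      refine Finset.sum_bij' (fun u _ => 2 * b + u) (fun u _ => u - 2 * b) ?_ ?_ ?_ ?_ ?_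
      · intro u hu; simpa [h.map_two_mul, -map_mul] using hu
      · intro u hu; simpa [h.map_two_mul, -map_mul] using hu
      · intros; ring
      · intros; ring
      · intros; rfl
    have h2 : (ψ (2 * b) - 1) * ∑ u with π u ≠ 0, ψ u = 0 := by linear_combination h1
    exact (mul_eq_zero.mp h2).resolve_left (sub_ne_zero.mpr hb)
  rw [Finset.sum_mul_sum, ← Finset.sum_product', ← Finset.diag_union_offDiag,
    Finset.sum_union (Finset.disjoint_diag_offDiag _)]
  have h3 : ∑ x ∈ (Finset.univ : Finset ι).offDiag, ψ (t x.1) * ψ (-t x.2) = 0 := by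
    rw [← h0, ← h.image_offDiag, Finset.sum_image h.injOn_sub]
    simp_rw [← AddChar.map_add_eq_mul, ← sub_eq_add_neg]
  rw [h3, add_zero, Finset.sum_diag]
  simp [← AddChar.map_add_eq_mul]

/-- Here `ψ(t + 2t') = ψ(t)`, so the vanishing sum of `ψ` over `R` is a nonzero multiple of the sum
over representatives. -/
lemma sum_eq_zero (h : IsTeichmuller π t) {A : Type*} [CommRing A] [IsDomain A] [CharZero A]
    (ψ : AddChar R A) (hψ : ψ ≠ 0) (h2 : ∀ b, ψ (2 * b) = 1) : ∑ i, ψ (t i) = 0 := by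
  have h0 := AddChar.sum_eq_zero_iff_ne_zero.mpr hψ
  rw [← Fintype.sum_bijective _ h.bijective_two_digits
    (fun ij : ι × ι => ψ (t ij.1)) ψ (fun ij => by
      rw [AddChar.map_add_eq_mul, h2, mul_one]), Fintype.sum_prod_type] at h0
  simp only [Finset.sum_const, Finset.card_univ, nsmul_eq_mul, ← Finset.mul_sum] at h0
  refine (mul_eq_zero.mp h0).resolve_left ?_
  have : Nonempty ι := ⟨(h.bijective.2 0).choose⟩
  exact Nat.cast_ne_zero.mpr Fintype.card_ne_zero

end IsTeichmuller

/-- Descent: a sum of two squares divisible by `4` has both terms even, so halving reduces `k` by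
one until `a² + b² = 2`. -/
lemma sq_eq_four_pow {k : ℕ} : ∀ {a b : ℤ}, a ^ 2 + b ^ 2 = 2 * 4 ^ k →
    a ^ 2 = 4 ^ k ∧ b ^ 2 = 4 ^ k := by
  induction k with
  | zero =>
    intro a b h
    have ha : a ≤ 1 := by nlinarith [sq_nonneg b, sq_nonneg (a - 1)]
    have ha' : -1 ≤ a := by nlinarith [sq_nonneg b, sq_nonneg (a + 1)]
    have hb : b ≤ 1 := by nlinarith [sq_nonneg a]
    have hb' : -1 ≤ b := by nlinarith [sq_nonneg a]
    interval_cases a <;> interval_cases b <;> simp_all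
  | succ k ih =>
    intro a b h
    have hmod : (a ^ 2 + b ^ 2) % 4 = 0 := by rw [h, pow_succ]; omega
    have ha : Even a ∧ Even b := by
      rcases Int.even_or_odd' a with ⟨c, rfl | rfl⟩ <;>
        rcases Int.even_or_odd' b with ⟨d, rfl | rfl⟩
      · exact ⟨even_two_mul c, even_two_mul d⟩
      all_goals ring_nf at hmod; omega
    obtain ⟨⟨c, rfl⟩, ⟨d, rfl⟩⟩ := ha
    have := ih (a := c) (b := d) (by rw [pow_succ 4] at h; linarith)
    rw [pow_succ 4]
    constructor <;> linarith [this.1, this.2]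

instance nontrivial_zmod_four : Nontrivial (ZMod 4) := ⟨0, 1, by decide⟩

/-! ### The Galois ring `ℤ₄[X] / (h)` -/

/-- Reduction modulo `2`. -/
def mod2 : ZMod 4 →+* ZMod 2 := ZMod.castHom (by norm_num : 2 ∣ 4) (ZMod 2)

lemma mod2_eq_zero_iff : ∀ z, mod2 z = 0 ↔ 2 * z = 0 := by unfold mod2; decide

lemma exists_eq_two_mul_of_mod2 : ∀ z, mod2 z = 0 → ∃ w, z = 2 * w := by unfold mod2; decide

lemma mul_self_of_mod2_ne_zero : ∀ z, mod2 z ≠ 0 → z * z = 1 := by unfold mod2; decide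

lemma map_mod2_eq_zero_iff (f : (ZMod 4)[X]) : f.map mod2 = 0 ↔ 2 * f = 0 := by
  have h2 : (2 : (ZMod 4)[X]) = C 2 := rfl
  simp only [Polynomial.ext_iff, coeff_map, coeff_zero, h2, coeff_C_mul, mod2_eq_zero_iff]

lemma exists_eq_two_mul_of_map_mod2 (f : (ZMod 4)[X]) (hf : f.map mod2 = 0) :
    ∃ g, f = 2 * g := by
  have h2 : (2 : (ZMod 4)[X]) = C 2 := rfl
  have : ∀ i, ∃ w, f.coeff i = 2 * w := fun i =>
    exists_eq_two_mul_of_mod2 _ (by rw [← coeff_map, hf, coeff_zero])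
  choose w hw using this
  refine ⟨∑ i ∈ f.support, C (w i) * X ^ i, ?_⟩
  conv_lhs => rw [f.as_sum_support_C_mul_X_pow]
  rw [Finset.mul_sum]
  refine Finset.sum_congr rfl fun i _ => ?_
  rw [hw, h2, C_mul, mul_assoc]

section GaloisRing

variable {m : ℕ} {h₂ : (ZMod 2)[X]} {h : (ZMod 4)[X]}

lemma IsLift.map_eq (hh : IsLift m h₂ h) : h.map mod2 = h₂ := hh.2.2.1

/-- Reduction modulo `2` from the Galois ring `ℤ₄[X] / (h)` to its residue field. -/
noncomputable def reduction (hh : IsLift m h₂ h) : AdjoinRoot h →+* AdjoinRoot h₂ :=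
  AdjoinRoot.map mod2 h h₂ (dvd_of_eq hh.map_eq.symm)

lemma reduction_mk (hh : IsLift m h₂ h) (f : (ZMod 4)[X]) :
    reduction hh (AdjoinRoot.mk h f) = AdjoinRoot.mk h₂ (f.map mod2) := by
  have : (reduction hh).comp (AdjoinRoot.mk h) =
      (AdjoinRoot.mk h₂).comp (mapRingHom mod2) := by
    apply Polynomial.ringHom_ext
    · intro a
      simp [reduction]
    · simp [reduction]
  exact DFunLike.congr_fun this f

lemma reduction_eq_zero (hh : IsLift m h₂ h) (a : AdjoinRoot h) (ha : reduction hh a = 0) :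
    ∃ b, a = 2 * b := by
  obtain ⟨f, rfl⟩ := AdjoinRoot.mk_surjective a
  rw [reduction_mk, AdjoinRoot.mk_eq_zero] at ha
  obtain ⟨k, hk⟩ := ha
  obtain ⟨k', rfl⟩ := map_surjective mod2 (ZMod.castHom_surjective _) k
  obtain ⟨g, hg⟩ := exists_eq_two_mul_of_map_mod2 (f - h * k') (by
    rw [Polynomial.map_sub, hk, Polynomial.map_mul, hh.map_eq, sub_self])
  refine ⟨AdjoinRoot.mk h g, ?_⟩
  have := congrArg (AdjoinRoot.mk h) hg
  rwa [map_sub, map_mul, map_mul, AdjoinRoot.mk_self, zero_mul, sub_zero, map_ofNat] at this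

/-- If `2f = hk`, reduction gives `h₂k̄ = 0`, so `k = 2k'` and `2(f - hk') = 0`; thus `f` and `hk'`
agree modulo `2`. -/
lemma two_mul_eq_zero_iff (hh : IsLift m h₂ h) (hne : h₂ ≠ 0) (a : AdjoinRoot h) :
    2 * a = 0 ↔ reduction hh a = 0 := by
  constructor
  · intro ha
    obtain ⟨f, rfl⟩ := AdjoinRoot.mk_surjective a
    have ha' : AdjoinRoot.mk h (2 * f) = 0 := by rw [map_mul, map_ofNat, ha]
    rw [AdjoinRoot.mk_eq_zero] at ha'
    obtain ⟨k, hk⟩ := ha'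
    have h2 : (2 : (ZMod 2)[X]) = 0 := CharTwo.two_eq_zero
    have hk0 : k.map mod2 = 0 := by
      have := congrArg (Polynomial.map mod2) hk
      rw [Polynomial.map_mul, Polynomial.map_ofNat, h2, zero_mul, Polynomial.map_mul,
        hh.map_eq] at this
      exact (mul_eq_zero.mp this.symm).resolve_left hne
    obtain ⟨k', rfl⟩ := exists_eq_two_mul_of_map_mod2 k hk0
    have h0 : (f - h * k').map mod2 = 0 := by
      rw [map_mod2_eq_zero_iff]
      linear_combination hk
    rw [Polynomial.map_sub, Polynomial.map_mul, hh.map_eq, sub_eq_zero] at h0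
    rw [reduction_mk, AdjoinRoot.mk_eq_zero, h0]
    exact dvd_mul_right _ _
  · intro ha
    obtain ⟨b, rfl⟩ := reduction_eq_zero hh a ha
    have h4 : (4 : AdjoinRoot h) = 0 := by
      have : (4 : ZMod 4) = 0 := by decide
      rw [← map_ofNat (algebraMap (ZMod 4) (AdjoinRoot h)) 4, this, map_zero]
    linear_combination b * h4

/-- The Teichmüller representatives `1, ξ, …, ξⁿ⁻¹, 0` of the Galois ring. -/
noncomputable def teich (m : ℕ) (h : (ZMod 4)[X]) : Fin (2 ^ m - 1 + 1) → AdjoinRoot h :=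
  Fin.snoc (α := fun _ => AdjoinRoot h) (fun j : Fin (2 ^ m - 1) => AdjoinRoot.root h ^ (j : ℕ)) 0

@[simp] lemma teich_castSucc (j : Fin (2 ^ m - 1)) :
    teich m h j.castSucc = AdjoinRoot.root h ^ (j : ℕ) :=
  Fin.snoc_castSucc (α := fun _ => AdjoinRoot h) _ _ _

@[simp] lemma teich_last : teich m h (Fin.last _) = 0 :=
  Fin.snoc_last (α := fun _ => AdjoinRoot h) _ _

lemma root_pow (hh : IsLift m h₂ h) : AdjoinRoot.root h ^ (2 ^ m - 1) = 1 := by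
  have := AdjoinRoot.mk_eq_zero.mpr hh.2.2.2
  simpa [sub_eq_zero] using this

lemma card_adjoinRoot_residue (hh₂ : IsPrimitiveIrreducible m h₂) :
    Nat.card (AdjoinRoot h₂) = 2 ^ m := by
  have : Fact (Irreducible h₂) := ⟨hh₂.1⟩
  let pb := AdjoinRoot.powerBasis hh₂.1.ne_zero
  have := Nat.card_congr pb.basis.equivFun.toEquiv
  rw [this, Nat.card_eq_fintype_card, Fintype.card_fun, Fintype.card_fin]
  simp [pb, hh₂.2.1]

theorem isTeichmuller_teich (hm : 2 ≤ m) (hh₂ : IsPrimitiveIrreducible m h₂)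
    (hh : IsLift m h₂ h) [Fact (Irreducible h₂)] : IsTeichmuller (reduction hh) (teich m h) where
  four_eq_zero := by
    have : (4 : ZMod 4) = 0 := by decide
    rw [← map_ofNat (algebraMap (ZMod 4) (AdjoinRoot h)) 4, this, map_zero]
  two_mul_eq_zero := two_mul_eq_zero_iff hh hh₂.1.ne_zero
  exists_eq_two_mul := reduction_eq_zero hh
  bijective := by
    have hm2 : 2 ^ 2 ≤ 2 ^ m := Nat.pow_le_pow_right (by norm_num) hm
    have hfin : Finite (AdjoinRoot h₂) := Nat.finite_of_card_ne_zero (by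
      rw [card_adjoinRoot_residue hh₂]; positivity)
    have := Fintype.ofFinite (AdjoinRoot h₂)
    rw [Fintype.bijective_iff_injective_and_card]
    constructor
    · have hr : reduction hh (AdjoinRoot.root h) = AdjoinRoot.root h₂ := AdjoinRoot.map_root _ _ _ _
      have h0 : AdjoinRoot.root h₂ ≠ 0 := by
        intro h0
        have := hh₂.2.2
        rw [h0] at this
        have h1 := pow_orderOf_eq_one (0 : AdjoinRoot h₂)
        rw [this, zero_pow (by omega)] at h1
        exact zero_ne_one h1
      intro i j hij
      induction i using Fin.lastCases with
      | last =>
        induction j using Fin.lastCases with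
        | last => rfl
        | cast j =>
          simp only [teich_last, teich_castSucc, map_zero, map_pow, hr] at hij
          exact absurd hij.symm (pow_ne_zero _ h0)
      | cast i =>
        induction j using Fin.lastCases with
        | last =>
          simp only [teich_last, teich_castSucc, map_zero, map_pow, hr] at hij
          exact absurd hij (pow_ne_zero _ h0)
        | cast j =>
          simp only [teich_castSucc, map_pow, hr] at hij
          have := pow_injOn_Iio_orderOf (x := AdjoinRoot.root h₂) (by simp [hh₂.2.2])
            (by simp [hh₂.2.2]) hij
          rw [Fin.ext this]
    · rw [Fintype.card_fin, ← Nat.card_eq_fintype_card, card_adjoinRoot_residue hh₂]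
      omega
  exists_sq := by
    intro i
    induction i using Fin.lastCases with
    | last => exact ⟨0, by simp⟩
    | cast j =>
      -- Since `ξ` to the power `2ᵐ` is `ξ`, raising to the power `2ᵐ⁻¹` gives a square root of each
      -- power of `ξ`.
      refine ⟨AdjoinRoot.root h ^ ((j : ℕ) * 2 ^ (m - 1)), ?_⟩
      rw [teich_castSucc, ← pow_mul, mul_assoc, ← pow_succ, Nat.sub_add_cancel (by omega)]
      have hp : AdjoinRoot.root h ^ 2 ^ m = AdjoinRoot.root h := by
        rw [← Nat.sub_add_cancel (Nat.one_le_two_pow (n := m)), pow_succ, root_pow hh, one_mul]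
      rw [mul_comm, pow_mul, hp]

/-- The basis `1, ξ, …, ξᵐ⁻¹` of the Galois ring. -/
noncomputable def galoisBasis (hh : IsLift m h₂ h) :
    Module.Basis (Fin m) (ZMod 4) (AdjoinRoot h) :=
  (AdjoinRoot.powerBasis' hh.1).basis.reindex (finCongr hh.2.1)

lemma galoisBasis_apply (hh : IsLift m h₂ h) (i : Fin m) :
    galoisBasis hh i = AdjoinRoot.root h ^ (i : ℕ) := by
  simp [galoisBasis]
  rfl

lemma eq_zero_of_forall_functional (hh : IsLift m h₂ h) (a : AdjoinRoot h)
    (ha : ∀ l : AdjoinRoot h →ₗ[ZMod 4] ZMod 4, l a = 0) : a = 0 := by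
  rw [(galoisBasis hh).ext_elem_iff]
  intro i
  simpa using ha ((galoisBasis hh).coord i)

end GaloisRing
/-! ### Cyclic codes and functionals -/

lemma coeff_toPoly {n : ℕ} (c : Fin n → ZMod 4) (j : Fin n) : (toPoly c).coeff j = c j := by
  rw [toPoly, finsetSum_coeff, Finset.sum_eq_single j]
  · simp
  · intro i _ hij
    rw [coeff_C_mul_X_pow, if_neg]
    exact fun h => hij (Fin.ext h.symm)
  · simp

lemma toPoly_injective {n : ℕ} : Function.Injective (toPoly (n := n)) := by
  intro c d h
  funext j
  rw [← coeff_toPoly c, h, coeff_toPoly]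

lemma natDegree_toPoly_lt {n : ℕ} (hn : 0 < n) (c : Fin n → ZMod 4) :
    (toPoly c).natDegree < n := by
  rw [toPoly]
  refine lt_of_le_of_lt (natDegree_sum_le_of_forall_le (n := n - 1) _ _ fun i _ => ?_) (by omega)
  exact (natDegree_C_mul_X_pow_le _ _).trans (by omega)

/-- If a functional on `ℤ₄[X]`, periodic of period `n`, kills the ideal `(p)`, then the polynomial
`∑ Λ(Xʲ) Xʲ` is killed by the reciprocal of `p` modulo `Xⁿ - 1`. -/
lemma dvd_reverse_mul_toPoly {n : ℕ} (hn : 0 < n) (Λ : (ZMod 4)[X] →ₗ[ZMod 4] ZMod 4)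
    (hper : ∀ f, Λ (f * X ^ n) = Λ f) {p : (ZMod 4)[X]} (hp : ∀ f, Λ (p * f) = 0) :
    X ^ n - 1 ∣ p.reverse * toPoly fun j : Fin n => Λ (X ^ (j : ℕ)) := by
  let x : AdjoinRoot (X ^ n - 1 : (ZMod 4)[X]) := AdjoinRoot.root _
  have hx : x ^ n = 1 := by
    have := AdjoinRoot.mk_self (f := (X ^ n - 1 : (ZMod 4)[X]))
    rwa [map_sub, map_pow, AdjoinRoot.mk_X, map_one, sub_eq_zero] at this
  let y := x ^ (n - 1)
  have hxy : x * y = 1 := by rw [← pow_succ', Nat.sub_add_cancel hn, hx]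
  -- By periodicity, `Φ` turns multiplication by `X` into multiplication by `x⁻¹ = y`, so `Φ(p) =
  -- p(x⁻¹) Φ(1)`. Up to a power of `x`, `p(x⁻¹)` is the reciprocal of `p` at `x`, and `Φ(1)` is the
  -- polynomial in question.
  let Φ : (ZMod 4)[X] →ₗ[ZMod 4] AdjoinRoot (X ^ n - 1 : (ZMod 4)[X]) :=
    { toFun := fun f => ∑ j ∈ Finset.range n, Λ (f * X ^ j) • x ^ j
      map_add' := fun f g => by
        simp only [add_mul, map_add, add_smul, Finset.sum_add_distrib]
      map_smul' := fun a f => by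
        simp only [smul_mul_assoc, map_smul, Finset.smul_sum, smul_assoc, RingHom.id_apply] }
  have hΦ : ∀ f, Φ f = ∑ j ∈ Finset.range n, Λ (f * X ^ j) • x ^ j := fun f => rfl
  have hshift : ∀ f, Φ (f * X) = y * Φ f := by
    intro f
    have h1 : x * Φ (f * X) = Φ f := by
      rw [hΦ, Finset.mul_sum]
      have h2 : ∀ j ∈ Finset.range n, x * Λ (f * X * X ^ j) • x ^ j =
          Λ (f * X ^ (j + 1)) • x ^ (j + 1) := fun j _ => by
        rw [mul_smul_comm, ← pow_succ', mul_assoc, ← pow_succ']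
      rw [Finset.sum_congr rfl h2]
      have h3 := (Finset.sum_range_succ (fun j => Λ (f * X ^ j) • x ^ j) n).symm.trans
        (Finset.sum_range_succ' (fun j => Λ (f * X ^ j) • x ^ j) n)
      rw [hper, hx, pow_zero, pow_zero, mul_one] at h3
      exact (add_right_cancel h3).symm
    rw [← h1, ← mul_assoc, mul_comm y x, hxy, one_mul]
  have hpow : ∀ k f, Φ (f * X ^ k) = y ^ k * Φ f := by
    intro k
    induction k with
    | zero => intro f; simp
    | succ k ih => intro f; rw [pow_succ, ← mul_assoc, hshift, ih, ← mul_assoc, pow_succ']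
  have hmul : ∀ q : (ZMod 4)[X], Φ q = aeval y q * Φ 1 := by
    intro q
    induction q using Polynomial.induction_on' with
    | add f g hf hg => rw [map_add, map_add, add_mul, hf, hg]
    | monomial k a =>
      rw [← C_mul_X_pow_eq_monomial, ← smul_eq_C_mul, map_smul, map_smul, smul_mul_assoc,
        aeval_X_pow, ← hpow, one_mul]
  have h0 : aeval y p * Φ 1 = 0 := by
    rw [← hmul, hΦ]
    exact Finset.sum_eq_zero fun j _ => by rw [hp, zero_smul]
  let _ : Invertible y := ⟨x, hxy, by rw [mul_comm, hxy]⟩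
  have hrev : aeval x p.reverse * y ^ p.natDegree = aeval y p :=
    eval₂_reverse_mul_pow (algebraMap (ZMod 4) (AdjoinRoot (X ^ n - 1 : (ZMod 4)[X]))) y p
  have hpoly : AdjoinRoot.mk (X ^ n - 1) (toPoly fun j : Fin n => Λ (X ^ (j : ℕ))) = Φ 1 := by
    rw [hΦ, Finset.sum_range, toPoly, map_sum]
    refine Finset.sum_congr rfl fun j _ => ?_
    rw [← smul_eq_C_mul, ← AdjoinRoot.smul_mk, map_pow (AdjoinRoot.mk _), AdjoinRoot.mk_X,
      one_mul]
  rw [← AdjoinRoot.mk_eq_zero, map_mul, hpoly, ← AdjoinRoot.aeval_eq]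
  calc aeval x p.reverse * Φ 1
      = (x * y) ^ p.natDegree * (aeval x p.reverse * Φ 1) := by rw [hxy, one_pow, one_mul]
    _ = x ^ p.natDegree * ((aeval x p.reverse * y ^ p.natDegree) * Φ 1) := by ring
    _ = 0 := by rw [hrev, h0, mul_zero]

/-! ### The code `D` as a code of functionals, its cardinality and its dual. -/

section Codes

variable {m : ℕ} {h₂ : (ZMod 2)[X]} {h : (ZMod 4)[X]}

lemma two_pow_sub_one_pos (hm : 2 ≤ m) : m < 2 ^ m - 1 + 1 ∧ m ≤ 2 ^ m - 1 ∧ 0 < 2 ^ m - 1 := by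
  have h1 := Nat.lt_two_pow_self (n := m)
  omega

lemma isCoprime_X_sub_one (hm : 2 ≤ m) (hh₂ : IsPrimitiveIrreducible m h₂)
    (hh : IsLift m h₂ h) : IsCoprime (X - 1 : (ZMod 4)[X]) h := by
  have h1 : mod2 (h.eval 1) ≠ 0 := by
    intro h0
    refine hh₂.1.not_isRoot_of_natDegree_ne_one (by rw [hh₂.2.1]; omega) (x := 1) ?_
    rw [IsRoot, ← hh.map_eq, ← h0, ← map_one mod2, eval_map_apply]
  have hd : (X - 1 : (ZMod 4)[X]) ∣ h - C (h.eval 1) := by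
    have := X_sub_C_dvd_sub_C_eval (a := (1 : ZMod 4)) (p := h)
    rwa [C_1] at this
  obtain ⟨k, hk⟩ := hd
  -- An irreducible `h₂` of degree at least `2` has no root at `1`, so `h(1)` is odd and is its own
  -- inverse in `ℤ₄`.
  refine ⟨-k * C (h.eval 1), C (h.eval 1), ?_⟩
  have hu : C (h.eval 1) * C (h.eval 1) = 1 := by
    rw [← C_mul, mul_self_of_mod2_ne_zero _ h1, C_1]
  linear_combination C (h.eval 1) * hk + hu

lemma monic_X_sub_one_mul (hh : IsLift m h₂ h) : ((X - 1) * h : (ZMod 4)[X]).Monic := by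
  have := (monic_X_sub_C (1 : ZMod 4)).mul hh.1
  rwa [C_1] at this

/-- The check polynomial `(X - 1) h` of `D` divides `Xⁿ - 1`. -/
lemma mul_divByMonic_eq (hm : 2 ≤ m) (hh₂ : IsPrimitiveIrreducible m h₂) (hh : IsLift m h₂ h) :
    ((X - 1) * h) * ((X ^ (2 ^ m - 1) - 1) /ₘ ((X - 1) * h)) = X ^ (2 ^ m - 1) - 1 := by
  obtain ⟨q, hq⟩ := (isCoprime_X_sub_one hm hh₂ hh).mul_dvd
    (sub_one_dvd_pow_sub_one X _) hh.2.2.2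
  rw [hq, mul_divByMonic_cancel_left _ (monic_X_sub_one_mul hh)]

lemma monic_X_pow_sub_one {n : ℕ} (hn : n ≠ 0) : (X ^ n - 1 : (ZMod 4)[X]).Monic := by
  have := monic_X_pow_sub_C (1 : ZMod 4) hn
  rwa [C_1] at this

/-- The reciprocal of `(X - 1)h` is thus a check polynomial for `g`. Reversal is multiplicative here
because the product of the leading coefficients is nonzero. -/
lemma reverse_mul_dualGenerator (hm : 2 ≤ m) (hh₂ : IsPrimitiveIrreducible m h₂)
    (hh : IsLift m h₂ h) :
    ((X - 1) * h).reverse * dualGenerator m h = 1 - X ^ (2 ^ m - 1) := by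
  have hn := (two_pow_sub_one_pos hm).2.2
  have hq := mul_divByMonic_eq hm hh₂ hh
  rw [dualGenerator, ← reverse_mul, hq]
  · have : (X ^ (2 ^ m - 1) - 1 : (ZMod 4)[X]) = X ^ (2 ^ m - 1) + C (-1) := by
      rw [C_neg, C_1, sub_eq_add_neg]
    rw [this, reverse_add_C, natDegree_X_pow, C_neg, C_1]
    have h1 := reverse_mul_X_pow (1 : (ZMod 4)[X]) (2 ^ m - 1)
    have h2 : reverse (1 : (ZMod 4)[X]) = 1 := by rw [← C_1, reverse_C]
    rw [one_mul, h2] at h1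
    rw [h1]
    ring
  · have hmon := leadingCoeff_monic_mul (monic_X_sub_one_mul hh)
      (q := ((X ^ (2 ^ m - 1) - 1) /ₘ ((X - 1) * h)))
    rw [hq, (monic_X_pow_sub_one hn.ne').leadingCoeff] at hmon
    rw [(monic_X_sub_one_mul hh).leadingCoeff, one_mul, ← hmon]
    exact one_ne_zero

/-- The word `(ε + l(t))`, `t` running through the Teichmüller representatives. -/
noncomputable def functionalWord (m : ℕ) (h : (ZMod 4)[X])
    (l : AdjoinRoot h →ₗ[ZMod 4] ZMod 4) (ε : ZMod 4) : Fin (2 ^ m - 1 + 1) → ZMod 4 :=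
  fun i => ε + l (teich m h i)

/-- As `(X - 1)h` divides `Xⁿ - 1`, `h` divides `1 + X + ⋯ + Xⁿ⁻¹`. This gives the overall parity
check of the functional words. -/
lemma sum_teich (hm : 2 ≤ m) (hh₂ : IsPrimitiveIrreducible m h₂) (hh : IsLift m h₂ h) :
    ∑ i, teich m h i = 0 := by
  rw [Fin.sum_univ_castSucc]
  simp only [teich_castSucc, teich_last, add_zero]
  rw [← Finset.sum_range (fun j => AdjoinRoot.root h ^ j)]
  have hd : h ∣ ∑ j ∈ Finset.range (2 ^ m - 1), X ^ j := by
    refine ⟨(X ^ (2 ^ m - 1) - 1) /ₘ ((X - 1) * h), ?_⟩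
    have hreg := (monic_X_sub_C (1 : ZMod 4)).isRegular.left
    rw [C_1] at hreg
    apply hreg
    change (X - 1) * _ = (X - 1) * _
    rw [mul_geom_sum, ← mul_assoc, mul_divByMonic_eq hm hh₂ hh]
  rw [← AdjoinRoot.mk_eq_zero, map_sum] at hd
  simpa using hd

lemma functionalWord_mem (hm : 2 ≤ m) (hh₂ : IsPrimitiveIrreducible m h₂) (hh : IsLift m h₂ h)
    (l : AdjoinRoot h →ₗ[ZMod 4] ZMod 4) (ε : ZMod 4) :
    functionalWord m h l ε ∈ codeD m h := by
  have hn := (two_pow_sub_one_pos hm).2.2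
  refine ⟨?_, ?_⟩
  · let Λ : (ZMod 4)[X] →ₗ[ZMod 4] ZMod 4 :=
      ε • (leval (1 : ZMod 4)) + l ∘ₗ (AdjoinRoot.mkₐ h).toLinearMap
    have hΛ : ∀ f, Λ f = ε * f.eval 1 + l (AdjoinRoot.mk h f) := fun f => rfl
    have hc : (fun i : Fin (2 ^ m - 1) => functionalWord m h l ε i.castSucc) =
        fun j : Fin (2 ^ m - 1) => Λ (X ^ (j : ℕ)) := by
      funext j
      simp [hΛ, functionalWord]
    have hd := dvd_reverse_mul_toPoly hn Λ (p := (X - 1) * h) (fun f => by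
      simp [hΛ, root_pow hh]) (fun f => by simp [hΛ])
    change toPoly _ ∈ Ideal.span _
    rw [hc]
    obtain ⟨a, ha⟩ := hd
    have hg := reverse_mul_dualGenerator hm hh₂ hh
    rw [Ideal.mem_span_pair]
    -- Write `r` for the reciprocal of `(X - 1)h` and `c` for the word polynomial. Multiplying `rc =
    -- (Xⁿ - 1)a` by `g` and using `rg = 1 - Xⁿ` gives `c = -ag` once the regular element `Xⁿ - 1`
    -- is cancelled.
    refine ⟨-a, 0, ?_⟩
    have hreg := (monic_X_pow_sub_one hn.ne').isRegular.left
    apply hreg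
    change (X ^ (2 ^ m - 1) - 1) * _ = (X ^ (2 ^ m - 1) - 1) * _
    linear_combination dualGenerator m h * ha -
      (toPoly fun j : Fin (2 ^ m - 1) => Λ (X ^ (j : ℕ))) * hg
  · have h4 : ((2 ^ m : ℕ) : ZMod 4) = 0 := by
      rw [ZMod.natCast_eq_zero_iff]
      exact pow_dvd_pow 2 hm
    simp only [functionalWord, Finset.sum_add_distrib, ← map_sum, sum_teich hm hh₂ hh, map_zero,
      add_zero, Finset.sum_const, Finset.card_univ, Fintype.card_fin, nsmul_eq_mul]
    rw [Nat.sub_add_cancel Nat.one_le_two_pow, h4, zero_mul]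

/-- The last coordinate, at `t = 0`, reads off `ε`; the first `m` coordinates then give `l` on the
basis `1, ξ, …, ξᵐ⁻¹`. -/
lemma functionalWord_injective (hm : 2 ≤ m) (hh : IsLift m h₂ h) :
    Function.Injective fun p : (AdjoinRoot h →ₗ[ZMod 4] ZMod 4) × ZMod 4 =>
      functionalWord m h p.1 p.2 := by
  rintro ⟨l, ε⟩ ⟨l', ε'⟩ he
  have h1 : ε = ε' := by
    have := congrFun he (Fin.last _)
    simpa [functionalWord] using this
  subst h1
  congr 1
  refine (galoisBasis hh).ext fun i => ?_
  have hi : (i : ℕ) < 2 ^ m - 1 := lt_of_lt_of_le i.2 (two_pow_sub_one_pos hm).2.1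
  have := congrFun he (Fin.castSucc ⟨i, hi⟩)
  simp only [functionalWord, teich_castSucc, add_right_inj] at this
  rw [galoisBasis_apply]
  exact this

lemma card_functional (hh : IsLift m h₂ h) :
    Nat.card (AdjoinRoot h →ₗ[ZMod 4] ZMod 4) = 4 ^ m := by
  rw [← Nat.card_congr ((galoisBasis hh).constr (ZMod 4)).toEquiv]
  simp

/-- Multiplying `c = ga` by the check polynomial gives `(Xⁿ - 1)a` up to sign, of degree at most `(m
+ 1) + (n - 1)`; hence `deg a ≤ m`. This bounds `D` by `4ᵐ⁺¹` words. -/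
lemma exists_quotient_mem_degreeLT (hm : 2 ≤ m) (hh₂ : IsPrimitiveIrreducible m h₂)
    (hh : IsLift m h₂ h) {c : Fin (2 ^ m - 1) → ZMod 4}
    (hc : c ∈ cyclicCode (2 ^ m - 1) (dualGenerator m h)) :
    ∃ a ∈ degreeLT (ZMod 4) (m + 1), toPoly c = dualGenerator m h * a := by
  have hn := (two_pow_sub_one_pos hm).2.2
  have hg := reverse_mul_dualGenerator hm hh₂ hh
  obtain ⟨u, v, huv⟩ := Ideal.mem_span_pair.mp (show toPoly c ∈ Ideal.span _ from hc)
  have ha : toPoly c = dualGenerator m h * (u - v * ((X - 1) * h).reverse) := by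
    linear_combination -huv + v * hg
  refine ⟨_, ?_, ha⟩
  set a := u - v * ((X - 1) * h).reverse
  rw [mem_degreeLT]
  by_cases ha0 : a = 0
  · rw [ha0, degree_zero]
    exact WithBot.bot_lt_coe _
  have hmul : (X ^ (2 ^ m - 1) - 1) * a = -(((X - 1) * h).reverse * toPoly c) := by
    rw [ha]; linear_combination a * hg
  have h1 := (monic_X_pow_sub_one hn.ne').natDegree_mul' ha0
  rw [hmul, natDegree_neg] at h1
  have h2 : (((X - 1) * h).reverse * toPoly c).natDegree ≤ (m + 1) + (2 ^ m - 1 - 1) := by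
    refine natDegree_mul_le.trans (add_le_add ?_ (Nat.le_sub_one_of_lt (natDegree_toPoly_lt hn c)))
    refine (reverse_natDegree_le _).trans (natDegree_mul_le.trans ?_)
    rw [hh.2.1, ← C_1, natDegree_X_sub_C, add_comm]
  have h3 : (X ^ (2 ^ m - 1) - 1 : (ZMod 4)[X]).natDegree = 2 ^ m - 1 := by
    rw [← C_1, natDegree_X_pow_sub_C]
  rw [degree_eq_natDegree ha0]
  exact_mod_cast (by omega : a.natDegree < m + 1)

lemma card_codeD_le (hm : 2 ≤ m) (hh₂ : IsPrimitiveIrreducible m h₂) (hh : IsLift m h₂ h) :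
    Nat.card (codeD m h) ≤ 4 ^ (m + 1) := by
  choose f hf hfc using fun v : codeD m h => exists_quotient_mem_degreeLT hm hh₂ hh v.2.1
  have e := Nat.card_congr (degreeLTEquiv (ZMod 4) (m + 1)).toEquiv
  have hfin : Finite (degreeLT (ZMod 4) (m + 1)) :=
    Finite.of_equiv _ (degreeLTEquiv (ZMod 4) (m + 1)).toEquiv.symm
  have := Nat.card_le_card_of_injective
    (fun v : codeD m h => (⟨f v, hf v⟩ : degreeLT (ZMod 4) (m + 1))) (by
    intro v w hvw
    have h1 : f v = f w := congrArg Subtype.val hvw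
    have h2 := toPoly_injective ((hfc v).trans ((congrArg _ h1).trans (hfc w).symm))
    have h3 : ∀ i : Fin (2 ^ m - 1), v.1 i.castSucc = w.1 i.castSucc := congrFun h2
    apply Subtype.ext
    funext i
    induction i using Fin.lastCases with
    | last =>
      have hv := v.2.2
      have hw := w.2.2
      rw [Fin.sum_univ_castSucc] at hv hw
      rw [Finset.sum_congr rfl fun i _ => h3 i] at hv
      exact add_left_cancel (hv.trans hw.symm)
    | cast i => exact h3 i)
  rw [e] at this
  simpa using this

lemma range_functionalWord (hm : 2 ≤ m) (hh₂ : IsPrimitiveIrreducible m h₂)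
    (hh : IsLift m h₂ h) :
    Set.range (fun p : (AdjoinRoot h →ₗ[ZMod 4] ZMod 4) × ZMod 4 => functionalWord m h p.1 p.2) =
      (codeD m h : Set _) := by
  apply Set.eq_of_subset_of_ncard_le
  · rintro _ ⟨p, rfl⟩
    exact functionalWord_mem hm hh₂ hh _ _
  · rw [← Set.image_univ, Set.ncard_image_of_injective _ (functionalWord_injective hm hh),
      Set.ncard_univ, Nat.card_prod, card_functional hh, Nat.card_zmod, ← pow_succ]
    exact card_codeD_le hm hh₂ hh
  · exact Set.toFinite _

lemma card_codeD (hm : 2 ≤ m) (hh₂ : IsPrimitiveIrreducible m h₂) (hh : IsLift m h₂ h) :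
    Nat.card (codeD m h) = 4 ^ (m + 1) := by
  refine le_antisymm (card_codeD_le hm hh₂ hh) ?_
  have h1 : (codeD m h : Set (Fin (2 ^ m - 1 + 1) → ZMod 4)).ncard = 4 ^ (m + 1) := by
    rw [← range_functionalWord hm hh₂ hh, ← Set.image_univ,
      Set.ncard_image_of_injective _ (functionalWord_injective hm hh), Set.ncard_univ,
      Nat.card_prod, card_functional hh, Nat.card_zmod, ← pow_succ]
  exact h1.ge

/-- Divisibility by `h` means vanishing at `ξ`, and the parity coordinate does not enter that sum
because it sits at `t = 0`. -/
lemma mem_codeH_iff (hh : IsLift m h₂ h) (v : Fin (2 ^ m - 1 + 1) → ZMod 4) :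
    v ∈ codeH m h ↔ ∑ i, v i • teich m h i = 0 ∧ ∑ i, v i = 0 := by
  refine and_congr ?_ Iff.rfl
  change toPoly _ ∈ Ideal.span _ ↔ _
  rw [Fin.sum_univ_castSucc, teich_last, smul_zero, add_zero]
  have hs : Ideal.span {h, X ^ (2 ^ m - 1) - 1} = Ideal.span {h} := by
    apply le_antisymm
    · rw [Ideal.span_le]
      rintro _ (rfl | rfl)
      · exact Ideal.mem_span_singleton_self _
      · exact Ideal.mem_span_singleton.mpr hh.2.2.2
    · exact Ideal.span_mono (by simp)
  rw [hs, Ideal.mem_span_singleton, ← AdjoinRoot.mk_eq_zero, toPoly, map_sum]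
  simp only [← smul_eq_C_mul, ← AdjoinRoot.smul_mk, map_pow, AdjoinRoot.mk_X, teich_castSucc]

/-- The extended cyclic code generated by `h` is the dual of `D`. -/
theorem codeH_eq_dual (hm : 2 ≤ m) (hh₂ : IsPrimitiveIrreducible m h₂) (hh : IsLift m h₂ h) :
    codeH m h = dual (codeD m h) := by
  ext v
  have hpair : ∀ (l : AdjoinRoot h →ₗ[ZMod 4] ZMod 4) (ε : ZMod 4),
      ∑ i, v i * functionalWord m h l ε i =
      ε * ∑ i, v i + l (∑ i, v i • teich m h i) := by
    intro l ε
    simp only [functionalWord, mul_add, Finset.sum_add_distrib, map_sum, map_smul, smul_eq_mul,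
      Finset.mul_sum, mul_comm]
  rw [mem_codeH_iff hh]
  constructor
  · rintro ⟨h1, h2⟩ b hb
    rw [← SetLike.mem_coe, ← range_functionalWord hm hh₂ hh] at hb
    obtain ⟨p, rfl⟩ := hb
    rw [hpair, h1, h2, mul_zero, map_zero, add_zero]
  · intro hv
    have hv' : ∀ (l : AdjoinRoot h →ₗ[ZMod 4] ZMod 4) (ε : ZMod 4),
        ε * ∑ i, v i + l (∑ i, v i • teich m h i) = 0 := fun l ε => by
      rw [← hpair]
      exact hv _ (functionalWord_mem hm hh₂ hh l ε)
    refine ⟨eq_zero_of_forall_functional hh _ fun l => ?_, ?_⟩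
    · simpa using hv' l 0
    · simpa using hv' 0 1

end Codes
/-! ### The weight enumerator of the quaternary Kerdock code -/

/-- The character `z ↦ iᶻ` of `ℤ₄` with values in the Gaussian integers. -/
def gaussChar : AddChar (ZMod 4) GaussianInt :=
  AddChar.zmodChar 4 (by decide : (⟨0, 1⟩ : GaussianInt) ^ 4 = 1)

lemma gaussChar_re (z : ZMod 4) : (gaussChar z).re = 1 - lee z := by
  rw [gaussChar, AddChar.zmodChar_apply]; revert z; decide

lemma gaussChar_neg (z : ZMod 4) : gaussChar (-z) = star (gaussChar z) := by
  rw [gaussChar, AddChar.zmodChar_apply, AddChar.zmodChar_apply]; revert z; decide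

lemma gaussChar_eq_one (z : ZMod 4) (hz : gaussChar z = 1) : z = 0 := by
  rw [gaussChar, AddChar.zmodChar_apply] at hz; revert z; decide

lemma sum_gaussChar_mul_re {A : Type*} [CommRing A] (T : ℤ → A) (s : GaussianInt) :
    ∑ ε, T (gaussChar ε * s).re = T s.re + T (-s.im) + T (-s.re) + T s.im := by
  have hu : (Finset.univ : Finset (ZMod 4)) = {0, 1, 2, 3} := by decide
  have e0 : gaussChar 0 = ⟨1, 0⟩ := by decide
  have e1 : gaussChar 1 = ⟨0, 1⟩ := by decide
  have e2 : gaussChar 2 = ⟨-1, 0⟩ := by decide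
  have e3 : gaussChar 3 = ⟨0, -1⟩ := by decide
  rw [hu, Finset.sum_insert (by decide), Finset.sum_insert (by decide),
    Finset.sum_insert (by decide), Finset.sum_singleton, e0, e1, e2, e3]
  simp only [Zsqrtd.re_mul, one_mul, zero_mul, mul_zero, add_zero, zero_add, mul_one, mul_neg,
    neg_mul, neg_neg]
  ring

section Kerdock

variable {m : ℕ} {h₂ : (ZMod 2)[X]} {h : (ZMod 4)[X]}

/-- The exponential sum of a functional over the Teichmüller representatives. -/
noncomputable def expSum (m : ℕ) (h : (ZMod 4)[X]) (l : AdjoinRoot h →ₗ[ZMod 4] ZMod 4) :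
    GaussianInt := ∑ i, gaussChar (l (teich m h i))

/-- The additive character of the Galois ring attached to a functional. -/
noncomputable def functionalChar (l : AdjoinRoot h →ₗ[ZMod 4] ZMod 4) :
    AddChar (AdjoinRoot h) GaussianInt :=
  gaussChar.compAddMonoidHom l.toAddMonoidHom

lemma functionalChar_apply (l : AdjoinRoot h →ₗ[ZMod 4] ZMod 4) (x : AdjoinRoot h) :
    functionalChar l x = gaussChar (l x) := rfl

/-- The Lee weight of `z` is `1 - Re iᶻ`; sum this over the `2ᵐ` coordinates. -/
lemma hammingNorm_functionalWord (l : AdjoinRoot h →ₗ[ZMod 4] ZMod 4) (ε : ZMod 4) :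
    (hammingNorm (gray (functionalWord m h l ε)) : ℤ) =
      2 ^ m - (gaussChar ε * expSum m h l).re := by
  have hre : ∀ {κ : Type} (s : Finset κ) (f : κ → GaussianInt),
      (∑ i ∈ s, f i).re = ∑ i ∈ s, (f i).re := fun s f =>
    map_sum (⟨⟨Zsqrtd.re, rfl⟩, fun _ _ => rfl⟩ : GaussianInt →+ ℤ) f s
  have h1 : gaussChar ε * expSum m h l = ∑ i, gaussChar (functionalWord m h l ε i) := by
    simp only [expSum, Finset.mul_sum, functionalWord, AddChar.map_add_eq_mul]
  rw [h1, hre, hammingNorm_gray]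
  simp only [gaussChar_re, Finset.sum_sub_distrib, Finset.sum_const, Finset.card_univ,
    Fintype.card_fin, Nat.sub_add_cancel (Nat.one_le_two_pow (n := m))]
  push_cast
  simp

lemma finite_adjoinRoot (hh : IsLift m h₂ h) : Finite (AdjoinRoot h) :=
  Finite.of_equiv _ (galoisBasis hh).equivFun.toEquiv.symm

lemma expSum_zero : expSum m h 0 = ⟨2 ^ m, 0⟩ := by
  have h1 : expSum m h 0 = ((2 ^ m : ℕ) : GaussianInt) := by
    simp only [expSum, LinearMap.zero_apply, AddChar.map_zero_eq_one, Finset.sum_const,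
      Finset.card_univ, Fintype.card_fin, Nat.sub_add_cancel (Nat.one_le_two_pow (n := m)),
      nsmul_eq_mul, mul_one]
  rw [h1]
  ext
  · rw [Zsqrtd.re_natCast]; push_cast; rfl
  · rw [Zsqrtd.im_natCast]

lemma expSum_eq_zero (hm : 2 ≤ m) (hh₂ : IsPrimitiveIrreducible m h₂) (hh : IsLift m h₂ h)
    {l : AdjoinRoot h →ₗ[ZMod 4] ZMod 4} (hl : l ≠ 0) (h2 : 2 • l = 0) : expSum m h l = 0 := by
  have : Fact (Irreducible h₂) := ⟨hh₂.1⟩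
  have := finite_adjoinRoot hh
  have := Fintype.ofFinite (AdjoinRoot h)
  refine (isTeichmuller_teich hm hh₂ hh).sum_eq_zero (functionalChar l) ?_ ?_
  · intro h0
    rw [AddChar.eq_zero_iff] at h0
    exact hl (LinearMap.ext fun x => gaussChar_eq_one _ (h0 x))
  · intro b
    have hb : l (2 * b) = 0 := by
      rw [two_mul, map_add, ← two_nsmul]
      exact LinearMap.congr_fun h2 b
    rw [functionalChar_apply, hb, AddChar.map_zero_eq_one]

/-- The sum times its conjugate is `2ᵐ`, so its real and imaginary parts satisfy `a² + b² = 2·4ᵏ`.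
-/
lemma expSum_sq {k : ℕ} (hm : 2 ≤ m) (hk : m = 2 * k + 1) (hh₂ : IsPrimitiveIrreducible m h₂)
    (hh : IsLift m h₂ h) {l : AdjoinRoot h →ₗ[ZMod 4] ZMod 4} (h2 : 2 • l ≠ 0) :
    (expSum m h l).re ^ 2 = (2 ^ k) ^ 2 ∧ (expSum m h l).im ^ 2 = (2 ^ k) ^ 2 := by
  have : Fact (Irreducible h₂) := ⟨hh₂.1⟩
  have := finite_adjoinRoot hh
  have := Fintype.ofFinite (AdjoinRoot h)
  obtain ⟨b, hb⟩ : ∃ b, l (2 * b) ≠ 0 := by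
    by_contra! hcon
    refine h2 (LinearMap.ext fun x => ?_)
    have := hcon x
    rw [two_mul, map_add, ← two_nsmul] at this
    exact this
  have hsum := (isTeichmuller_teich hm hh₂ hh).sum_sub_eq (functionalChar l) (b := b)
    fun h1 => hb (gaussChar_eq_one _ h1)
  have hstar : ∑ j, functionalChar l (-teich m h j) = star (expSum m h l) := by
    rw [expSum, star_sum]
    refine Finset.sum_congr rfl fun i _ => ?_
    rw [functionalChar_apply, map_neg, gaussChar_neg]
  rw [hstar, Fintype.card_fin] at hsum
  have hre := congrArg Zsqrtd.re
    (hsum.trans (congrArg Nat.cast (Nat.sub_add_cancel (Nat.one_le_two_pow (n := m)))))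
  change (expSum m h l * star (expSum m h l)).re = _ at hre
  rw [Zsqrtd.re_mul, Zsqrtd.re_star, Zsqrtd.im_star, Zsqrtd.re_natCast] at hre
  have := sq_eq_four_pow (k := k) (a := (expSum m h l).re) (b := (expSum m h l).im) (by
    have : ((2 ^ m : ℕ) : ℤ) = 2 * 4 ^ k := by
      rw [hk, pow_succ, pow_mul]; push_cast; ring
    rw [← this, ← hre]; ring)
  have h4 : ((2 : ℤ) ^ k) ^ 2 = 4 ^ k := by rw [← pow_mul, mul_comm, pow_mul]; norm_num
  rwa [h4]

open Classical in
lemma card_two_nsmul_eq_zero (hh : IsLift m h₂ h) [Fintype (AdjoinRoot h →ₗ[ZMod 4] ZMod 4)] :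
    Finset.card {l : AdjoinRoot h →ₗ[ZMod 4] ZMod 4 | 2 • l = 0} = 2 ^ m := by
  have h1 : (Fintype.piFinset fun _ : Fin m => ({0, 2} : Finset (ZMod 4))).card = 2 ^ m := by
    rw [Fintype.card_piFinset]
    simp only [Finset.prod_const, Finset.card_univ, Fintype.card_fin]
    rfl
  rw [← h1]
  symm
  have key : ∀ z : ZMod 4, z ∈ ({0, 2} : Finset (ZMod 4)) ↔ 2 • z = 0 := by decide
  let e := (galoisBasis hh).constr (ZMod 4) (M' := ZMod 4)
  refine Finset.card_equiv e.toEquiv fun v => ?_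
  rw [Fintype.mem_piFinset, Finset.mem_filter]
  simp only [Finset.mem_univ, true_and, key]
  have h2 : 2 • e.toEquiv v = e (2 • v) := (map_nsmul e 2 v).symm
  rw [h2, LinearEquiv.map_eq_zero_iff, funext_iff]
  rfl

lemma sum_expSum {k : ℕ} (hm : 2 ≤ m) (hk : m = 2 * k + 1) (hh₂ : IsPrimitiveIrreducible m h₂)
    (hh : IsLift m h₂ h) [Fintype (AdjoinRoot h →ₗ[ZMod 4] ZMod 4)] {A : Type*} [CommRing A]
    (T : ℤ → A) :
    ∑ l, ∑ ε, T (gaussChar ε * expSum m h l).re =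
      T (2 ^ m) + T (-2 ^ m) + (2 ^ (m + 2) - 2) * T 0 +
        2 ^ (m + 1) * (2 ^ m - 1) * (T (2 ^ k) + T (-2 ^ k)) := by
  classical
  -- The generic value is taken for all `4ᵐ` functionals, then corrected on the `2ᵐ` with `2l = 0`
  -- and once more at `l = 0`.
  have hval : ∀ l : AdjoinRoot h →ₗ[ZMod 4] ZMod 4, ∑ ε, T (gaussChar ε * expSum m h l).re =
      2 * (T (2 ^ k) + T (-2 ^ k)) +
        ((if 2 • l = 0 then 4 * T 0 - 2 * (T (2 ^ k) + T (-2 ^ k)) else 0) +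
          if l = 0 then T (2 ^ m) + T (-2 ^ m) - 2 * T 0 else 0) := by
    intro l
    rw [sum_gaussChar_mul_re]
    by_cases hl : l = 0
    · rw [if_pos (by rw [hl, smul_zero]), if_pos hl, hl, expSum_zero]
      simp only [neg_zero]
      ring
    · rw [if_neg hl]
      by_cases h2 : 2 • l = 0
      · rw [if_pos h2, expSum_eq_zero hm hh₂ hh hl h2]
        simp only [Zsqrtd.re_zero, Zsqrtd.im_zero, neg_zero]
        ring
      · rw [if_neg h2]
        obtain ⟨hr, hi⟩ := expSum_sq hm hk hh₂ hh h2
        rcases sq_eq_sq_iff_eq_or_eq_neg.mp hr with hr | hr <;>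
        rcases sq_eq_sq_iff_eq_or_eq_neg.mp hi with hi | hi <;>
          rw [hr, hi] <;> (try simp only [neg_neg]) <;> ring
  have hcard : Fintype.card (AdjoinRoot h →ₗ[ZMod 4] ZMod 4) = 4 ^ m := by
    rw [← Nat.card_eq_fintype_card, card_functional hh]
  rw [Finset.sum_congr rfl fun l _ => hval l, Finset.sum_add_distrib, Finset.sum_add_distrib,
    ← Finset.sum_filter, Finset.sum_const, Finset.sum_const, card_two_nsmul_eq_zero hh,
    Finset.card_univ, hcard, Finset.sum_ite_eq' Finset.univ (0 : AdjoinRoot h →ₗ[ZMod 4] ZMod 4),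
    if_pos (Finset.mem_univ _)]
  have h4 : (4 : A) ^ m = 2 ^ m * 2 ^ m := by rw [← mul_pow]; norm_num
  simp only [nsmul_eq_mul]
  push_cast
  rw [h4]
  ring

/-- The Gray image of `D` has the weight enumerator of the Kerdock code. -/
theorem weightEnumerator_codeD (hm : 2 ≤ m) (hodd : Odd m) (hh₂ : IsPrimitiveIrreducible m h₂)
    (hh : IsLift m h₂ h) :
    weightEnumerator (binaryImage (codeD m h)) = kerdockEnumerator m := by
  classical
  obtain ⟨k, hk⟩ := hodd
  have hfin : Finite (AdjoinRoot h →ₗ[ZMod 4] ZMod 4) :=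
    Finite.of_equiv _ ((galoisBasis hh).constr (ZMod 4)).toEquiv
  have := Fintype.ofFinite (AdjoinRoot h →ₗ[ZMod 4] ZMod 4)
  -- `T s` is the monomial of a word of weight `2ᵐ - s`.
  let T : ℤ → MvPolynomial (Fin 2) ℚ := fun s =>
    MvPolynomial.X 0 ^ (2 ^ m + s).toNat * MvPolynomial.X 1 ^ (2 ^ m - s).toNat
  have hT : ∀ s, T s =
      MvPolynomial.X 0 ^ (2 ^ m + s).toNat * MvPolynomial.X 1 ^ (2 ^ m - s).toNat := fun _ => rfl
  have h1 : weightEnumerator (binaryImage (codeD m h)) =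
      ∑ l, ∑ ε, T (gaussChar ε * expSum m h l).re := by
    rw [weightEnumerator_binaryImage, ← Fintype.sum_prod_type']
    symm
    refine Finset.sum_bij (fun p _ => functionalWord m h p.1 p.2) ?_ ?_ ?_ ?_
    · intro p _
      exact Finset.mem_filter.mpr ⟨Finset.mem_univ _, functionalWord_mem hm hh₂ hh _ _⟩
    · intro p _ q _ hpq
      exact functionalWord_injective hm hh hpq
    · intro c hc
      have := (Finset.mem_filter.mp hc).2
      rw [← SetLike.mem_coe, ← range_functionalWord hm hh₂ hh] at this
      obtain ⟨p, hp⟩ := this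
      exact ⟨p, Finset.mem_univ _, hp⟩
    · intro p _
      have hw := hammingNorm_functionalWord (m := m) p.1 p.2
      have h2 : ((2 ^ m : ℕ) : ℤ) = 2 ^ m := by push_cast; rfl
      have h3 : 2 ^ m - 1 + 1 = 2 ^ m := Nat.sub_add_cancel Nat.one_le_two_pow
      rw [hT]
      congr 2 <;> omega
  rw [h1, sum_expSum hm hk hh₂ hh T, kerdockEnumerator]
  have hk2 : (m - 1) / 2 = k := by omega
  have hkm : (2 : ℕ) ^ k ≤ 2 ^ m := Nat.pow_le_pow_right (by norm_num) (by omega)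
  have c1 : ((2 ^ m : ℕ) : ℤ) = 2 ^ m := by push_cast; rfl
  have c2 : ((2 ^ k : ℕ) : ℤ) = 2 ^ k := by push_cast; rfl
  have c3 : (0 : ℤ) < 2 ^ m := by positivity
  have c4 : (0 : ℤ) < 2 ^ k := by positivity
  have t1 : T (2 ^ m) = MvPolynomial.X 0 ^ 2 ^ (m + 1) := by
    rw [hT, sub_self, Int.toNat_zero, pow_zero, mul_one]; congr 1; omega
  have t2 : T (-2 ^ m) = MvPolynomial.X 1 ^ 2 ^ (m + 1) := by
    rw [hT, add_neg_cancel, Int.toNat_zero, pow_zero, one_mul]; congr 1; omega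
  have t3 : T 0 = MvPolynomial.X 0 ^ 2 ^ m * MvPolynomial.X 1 ^ 2 ^ m := by
    rw [hT]; congr 2
  have t4 : T (2 ^ k) =
      MvPolynomial.X 0 ^ (2 ^ m + 2 ^ k) * MvPolynomial.X 1 ^ (2 ^ m - 2 ^ k) := by
    rw [hT]; congr 2; omega
  have t5 : T (-2 ^ k) =
      MvPolynomial.X 0 ^ (2 ^ m - 2 ^ k) * MvPolynomial.X 1 ^ (2 ^ m + 2 ^ k) := by
    rw [hT]; congr 2 <;> omega
  simp only [hk2, t1, t2, t3, t4, t5, map_sub, map_mul, map_pow, map_ofNat, map_one]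
  ring

end Kerdock
/-! ### Coefficients of the MacWilliams transform -/

/-- The recursion comes from comparing coefficients in `(1 - X²) f' = ((u - v) - (u + v)X) f`. -/
lemma coeff_one_add_mul_one_sub (u v i : ℕ) :
    ((i : ℚ) + 2) * ((1 + X) ^ u * (1 - X) ^ v : ℚ[X]).coeff (i + 2) =
      ((u : ℚ) - v) * ((1 + X) ^ u * (1 - X) ^ v : ℚ[X]).coeff (i + 1) -
        ((u : ℚ) + v - i) * ((1 + X) ^ u * (1 - X) ^ v : ℚ[X]).coeff i ∧
    ((1 + X) ^ u * (1 - X) ^ v : ℚ[X]).coeff 1 = (u : ℚ) - v := by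
  set f : ℚ[X] := (1 + X) ^ u * (1 - X) ^ v with hf
  have h1 : (1 + X) * derivative ((1 + X : ℚ[X]) ^ u) = C (u : ℚ) * (1 + X) ^ u := by
    rcases u with _ | u
    · simp
    · rw [derivative_pow_succ]; simp; ring
  have h2 : (1 - X) * derivative ((1 - X : ℚ[X]) ^ v) = -C (v : ℚ) * (1 - X) ^ v := by
    rcases v with _ | v
    · simp
    · rw [derivative_pow_succ]; simp; ring
  have h3 : derivative f - X * (X * derivative f) =
      C ((u : ℚ) - v) * f - C ((u : ℚ) + v) * (X * f) := by
    rw [hf, derivative_mul, C_sub, C_add]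
    linear_combination (1 - X) * (1 - X) ^ v * h1 + (1 + X) * (1 + X) ^ u * h2
  have h4 : (X * derivative f).coeff i = i * f.coeff i := by
    rcases i with _ | i
    · simp
    · rw [coeff_X_mul, coeff_derivative]; push_cast; ring
  constructor
  · have := congrArg (fun p => coeff p (i + 1)) h3
    simp only [coeff_sub, coeff_C_mul, coeff_X_mul, h4, coeff_derivative] at this
    push_cast at this
    linear_combination this
  · have := congrArg (fun p => coeff p 0) h3
    simp only [coeff_sub, coeff_C_mul, coeff_X_mul_zero, coeff_derivative] at this
    have h0 : f.coeff 0 = 1 := by rw [hf, coeff_zero_eq_eval_zero]; simp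
    rw [h0] at this
    simpa using this

/-- The coefficients of degree at most `6` of `(1 + X) ^ u (1 - X) ^ v` in terms of `E = u + v` and
`d = u - v`. -/
lemma coeff_one_add_mul_one_sub_le_six {u v : ℕ} {E d : ℚ} (hE : (u : ℚ) + v = E)
    (hd : (u : ℚ) - v = d) :
    let f : ℚ[X] := (1 + X) ^ u * (1 - X) ^ v
    f.coeff 1 = d ∧ f.coeff 2 = (d ^ 2 - E) / 2 ∧ f.coeff 3 = (d ^ 3 - (3 * E - 2) * d) / 6 ∧
    f.coeff 4 = (d ^ 4 - (6 * E - 8) * d ^ 2 + 3 * E * (E - 2)) / 24 ∧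
    f.coeff 5 = (d * ((d ^ 4 - (6 * E - 8) * d ^ 2 + 3 * E * (E - 2)) / 24) -
      (E - 3) * ((d ^ 3 - (3 * E - 2) * d) / 6)) / 5 ∧
    f.coeff 6 = (d * ((d * ((d ^ 4 - (6 * E - 8) * d ^ 2 + 3 * E * (E - 2)) / 24) -
      (E - 3) * ((d ^ 3 - (3 * E - 2) * d) / 6)) / 5) -
      (E - 4) * ((d ^ 4 - (6 * E - 8) * d ^ 2 + 3 * E * (E - 2)) / 24)) / 6 := by
  intro f
  have h0 : f.coeff 0 = 1 := by simp only [f, coeff_zero_eq_eval_zero]; simp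
  have h1 := (coeff_one_add_mul_one_sub u v 0).2
  have r0 := (coeff_one_add_mul_one_sub u v 0).1
  have r1 := (coeff_one_add_mul_one_sub u v 1).1
  have r2 := (coeff_one_add_mul_one_sub u v 2).1
  have r3 := (coeff_one_add_mul_one_sub u v 3).1
  have r4 := (coeff_one_add_mul_one_sub u v 4).1
  rw [hE, hd] at r0 r1 r2 r3 r4
  rw [hd] at h1
  change f.coeff 1 = d at h1
  change _ * f.coeff 2 = _ * f.coeff 1 - _ * f.coeff 0 at r0
  change _ * f.coeff 3 = _ * f.coeff 2 - _ * f.coeff 1 at r1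
  change _ * f.coeff 4 = _ * f.coeff 3 - _ * f.coeff 2 at r2
  change _ * f.coeff 5 = _ * f.coeff 4 - _ * f.coeff 3 at r3
  change _ * f.coeff 6 = _ * f.coeff 5 - _ * f.coeff 4 at r4
  push_cast at r0 r1 r2 r3 r4
  have h2 : f.coeff 2 = (d ^ 2 - E) / 2 := by
    rw [h0, h1] at r0; linear_combination r0 / 2
  have h3 : f.coeff 3 = (d ^ 3 - (3 * E - 2) * d) / 6 := by
    rw [h1, h2] at r1; linear_combination r1 / 3
  have h4 : f.coeff 4 = (d ^ 4 - (6 * E - 8) * d ^ 2 + 3 * E * (E - 2)) / 24 := by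
    rw [h2, h3] at r2; linear_combination r2 / 4
  have h5 : f.coeff 5 = (d * ((d ^ 4 - (6 * E - 8) * d ^ 2 + 3 * E * (E - 2)) / 24) -
      (E - 3) * ((d ^ 3 - (3 * E - 2) * d) / 6)) / 5 := by
    rw [h3, h4] at r3; linear_combination r3 / 5
  refine ⟨h1, h2, h3, h4, h5, ?_⟩
  rw [h4, h5] at r4; linear_combination r4 / 6

lemma aeval_macWilliams (M : ℕ) (W : MvPolynomial (Fin 2) ℚ) :
    MvPolynomial.aeval ![1, (X : ℚ[X])] (macWilliams M W) =
      C (1 / (M : ℚ)) * MvPolynomial.aeval ![1 + X, (1 - X : ℚ[X])] W := by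
  rw [macWilliams, map_mul, MvPolynomial.aeval_C]
  congr 1
  rw [← AlgHom.comp_apply]
  congr 1
  apply MvPolynomial.algHom_ext
  intro i
  fin_cases i <;> simp

lemma aeval_kerdockEnumerator (m : ℕ) :
    MvPolynomial.aeval ![1 + X, (1 - X : ℚ[X])] (kerdockEnumerator m) =
      (1 + X) ^ 2 ^ (m + 1) * (1 - X) ^ 0 + (1 + X) ^ 0 * (1 - X) ^ 2 ^ (m + 1)
      + C (2 ^ (m + 1) * (2 ^ m - 1) : ℚ) *
        ((1 + X) ^ (2 ^ m + 2 ^ ((m - 1) / 2)) * (1 - X) ^ (2 ^ m - 2 ^ ((m - 1) / 2)) +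
          (1 + X) ^ (2 ^ m - 2 ^ ((m - 1) / 2)) * (1 - X) ^ (2 ^ m + 2 ^ ((m - 1) / 2)))
      + C (2 ^ (m + 2) - 2 : ℚ) * ((1 + X) ^ 2 ^ m * (1 - X) ^ 2 ^ m) := by
  simp only [kerdockEnumerator, map_add, map_mul, MvPolynomial.aeval_C, map_pow,
    MvPolynomial.aeval_X, Matrix.cons_val_zero, Matrix.cons_val_one, algebraMap_eq]
  ring

/-- The first coefficients of the MacWilliams transform of the Kerdock weight enumerator. -/
lemma coeff_aeval_kerdockEnumerator {m : ℕ} (hm : 3 ≤ m) (hodd : Odd m) :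
    let f := MvPolynomial.aeval ![1 + X, (1 - X : ℚ[X])] (kerdockEnumerator m)
    f.coeff 1 = 0 ∧ f.coeff 2 = 0 ∧ f.coeff 3 = 0 ∧ f.coeff 4 = 0 ∧ f.coeff 5 = 0 ∧
      f.coeff 6 ≠ 0 := by
  intro f
  obtain ⟨k, hk⟩ := hodd
  have hk2 : (m - 1) / 2 = k := by omega
  have hkm : (2 : ℕ) ^ k ≤ 2 ^ m := Nat.pow_le_pow_right (by norm_num) (by omega)
  have hf : f = _ := aeval_kerdockEnumerator m
  rw [hk2] at hf
  set E : ℚ := 2 ^ (m + 1) with hE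
  -- `s` is the difference of the exponents `2ᵐ ± 2ᵏ`. The relation `s² = E` cancels the
  -- coefficients of degrees `2` and `4`; the odd ones cancel by the symmetry `s ↦ -s`.
  set s : ℚ := 2 * 2 ^ k with hs
  have hsE : s ^ 2 = E := by
    rw [hs, hE, hk, ← pow_succ', ← pow_mul]; congr 1; ring
  have e1 : (2 : ℚ) ^ m = E / 2 := by rw [hE, pow_succ]; ring
  have e2 : (2 : ℚ) ^ (m + 2) = 2 * E := by rw [hE]; ring
  have hE16 : 16 ≤ E := by
    have : (2 : ℚ) ^ 4 ≤ 2 ^ (m + 1) := pow_le_pow_right₀ (by norm_num) (by omega)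
    rw [hE]; norm_num at this ⊢; exact this
  have c1 := coeff_one_add_mul_one_sub_le_six (u := 2 ^ (m + 1)) (v := 0) (E := E) (d := E)
    (by push_cast; ring) (by push_cast; ring)
  have c2 := coeff_one_add_mul_one_sub_le_six (u := 0) (v := 2 ^ (m + 1)) (E := E) (d := -E)
    (by push_cast; ring) (by push_cast; ring)
  have c3 := coeff_one_add_mul_one_sub_le_six (u := 2 ^ m + 2 ^ k) (v := 2 ^ m - 2 ^ k) (E := E)
    (d := s) (by push_cast [hkm]; linear_combination 2 * e1)
    (by push_cast [hkm]; linear_combination -hs)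
  have c4 := coeff_one_add_mul_one_sub_le_six (u := 2 ^ m - 2 ^ k) (v := 2 ^ m + 2 ^ k) (E := E)
    (d := -s) (by push_cast [hkm]; linear_combination 2 * e1)
    (by push_cast [hkm]; linear_combination hs)
  have c5 := coeff_one_add_mul_one_sub_le_six (u := 2 ^ m) (v := 2 ^ m) (E := E) (d := 0)
    (by push_cast; linear_combination 2 * e1) (by push_cast; ring)
  rw [e1, e2] at hf
  obtain ⟨a1, a2, a3, a4, a5, a6⟩ := c1
  obtain ⟨b1, b2, b3, b4, b5, b6⟩ := c2
  obtain ⟨d1, d2, d3, d4, d5, d6⟩ := c3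
  obtain ⟨g1, g2, g3, g4, g5, g6⟩ := c4
  obtain ⟨k1, k2, k3, k4, k5, k6⟩ := c5
  -- The factor `E²` is `4ᵐ⁺¹`, so the other factor is the number of words of weight `6` after the
  -- transform.
  have h6 : f.coeff 6 = E ^ 2 * (E * (E - 1) * (E - 2) * (E - 4) / 360) := by
    rw [hf]
    simp only [coeff_add, coeff_C_mul, a6, b6, d6, g6, k6]
    rw [← hsE]
    ring
  refine ⟨?_, ?_, ?_, ?_, ?_, ?_⟩
  · rw [hf]
    simp only [coeff_add, coeff_C_mul, a1, b1, d1, g1, k1]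
    ring
  · rw [hf]
    simp only [coeff_add, coeff_C_mul, a2, b2, d2, g2, k2]
    rw [← hsE]
    ring
  · rw [hf]
    simp only [coeff_add, coeff_C_mul, a3, b3, d3, g3, k3]
    ring
  · rw [hf]
    simp only [coeff_add, coeff_C_mul, a4, b4, d4, g4, k4]
    rw [← hsE]
    ring
  · rw [hf]
    simp only [coeff_add, coeff_C_mul, a5, b5, d5, g5, k5]
    ring
  · rw [h6]
    have p1 : 0 < E := by linarith
    have p2 : 0 < E - 1 := by linarith
    have p3 : 0 < E - 2 := by linarith
    have p4 : 0 < E - 4 := by linarith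
    positivity

open Classical in
lemma coeff_aeval_weightEnumerator {N : ℕ} (D : AddSubgroup (Fin N → ZMod 4)) (j : ℕ) :
    (MvPolynomial.aeval ![1, (X : ℚ[X])] (weightEnumerator (binaryImage D))).coeff j =
      Finset.card {c : Fin N → ZMod 4 | c ∈ D ∧ hammingNorm (gray c) = j} := by
  rw [weightEnumerator_binaryImage, map_sum, finsetSum_coeff]
  simp only [map_mul, map_pow, MvPolynomial.aeval_X, Matrix.cons_val_zero, Matrix.cons_val_one,
    one_pow, one_mul, coeff_X_pow]
  rw [Finset.sum_boole, Finset.filter_filter]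
  congr 3
  ext c
  rw [eq_comm]

/-- The minimal distance of the Gray image of a quaternary code whose weight enumerator is the
MacWilliams transform of the Kerdock weight enumerator. -/
theorem hasMinDistance_of_weightEnumerator {N m : ℕ} (hm : 3 ≤ m) (hodd : Odd m)
    {D : AddSubgroup (Fin N → ZMod 4)}
    (hD : weightEnumerator (binaryImage D) = macWilliams (4 ^ (m + 1)) (kerdockEnumerator m)) :
    HasMinDistance (binaryImage D) 6 := by
  classical
  have hM : (1 / ((4 ^ (m + 1) : ℕ) : ℚ)) ≠ 0 := by positivity
  have hc : ∀ j, (1 / ((4 ^ (m + 1) : ℕ) : ℚ)) *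
      (MvPolynomial.aeval ![1 + X, (1 - X : ℚ[X])] (kerdockEnumerator m)).coeff j =
      Finset.card {c : Fin N → ZMod 4 | c ∈ D ∧ hammingNorm (gray c) = j} := by
    intro j
    rw [← coeff_aeval_weightEnumerator, hD, aeval_macWilliams, coeff_C_mul]
  obtain ⟨h1, h2, h3, h4, h5, h6⟩ := coeff_aeval_kerdockEnumerator hm hodd
  constructor
  · have := hc 6
    have h0 : Finset.card {c : Fin N → ZMod 4 | c ∈ D ∧ hammingNorm (gray c) = 6} ≠ 0 := by
      intro h0
      rw [h0, Nat.cast_zero] at this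
      exact mul_ne_zero hM h6 this
    obtain ⟨c, hcm⟩ := Finset.card_ne_zero.mp h0
    obtain ⟨hcD, hc6⟩ := (Finset.mem_filter.mp hcm).2
    have hdist : hammingDist (gray c) (gray 0) = 6 := by rw [hammingDist_gray, sub_zero, hc6]
    refine ⟨gray c, ⟨c, hcD, rfl⟩, gray 0, ⟨0, D.zero_mem, rfl⟩, ?_, hdist⟩
    intro he
    rw [he, hammingDist_self] at hdist
    exact absurd hdist (by norm_num)
  · rintro e ⟨_, ⟨a, ha, rfl⟩, _, ⟨b, hb, rfl⟩, hne, he⟩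
    by_contra! hlt
    have hpos : e ≠ 0 := by
      rintro rfl
      exact hne (hammingDist_eq_zero.mp he)
    have hzero : (MvPolynomial.aeval ![1 + X, (1 - X : ℚ[X])] (kerdockEnumerator m)).coeff e
        = 0 := by
      interval_cases e <;> first | contradiction | assumption
    have := hc e
    rw [hzero, mul_zero] at this
    have h0 := Finset.card_eq_zero.mp (Nat.cast_eq_zero.mp this.symm)
    rw [hammingDist_gray] at he
    have hmem : a - b ∈ ({c : Fin N → ZMod 4 | c ∈ D ∧ hammingNorm (gray c) = e} :
        Finset (Fin N → ZMod 4)) :=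
      Finset.mem_filter.mpr ⟨Finset.mem_univ _, D.sub_mem ha hb, he⟩
    rw [h0] at hmem
    exact absurd hmem (Finset.notMem_empty _)

/-- At `x = y = 1` the transform evaluates the Kerdock enumerator at `(2, 0)`, where only the power
of `x` survives. -/
theorem ncard_of_weightEnumerator {N m : ℕ} (hm : 3 ≤ m)
    {D : AddSubgroup (Fin N → ZMod 4)}
    (hD : weightEnumerator (binaryImage D) = macWilliams (4 ^ (m + 1)) (kerdockEnumerator m)) :
    (binaryImage D).ncard = 2 ^ (2 ^ (m + 1) - 2 * m - 2) := by
  have h1 := congrArg (MvPolynomial.eval fun _ => (1 : ℚ)) hD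
  rw [eval_macWilliams, weightEnumerator, map_sum] at h1
  have hr : 2 ^ ((m - 1) / 2) < 2 ^ m := Nat.pow_lt_pow_right (by norm_num) (by omega)
  have e1 : 2 ^ m - 2 ^ ((m - 1) / 2) ≠ 0 := by omega
  have e2 : 2 ^ m + 2 ^ ((m - 1) / 2) ≠ 0 := by positivity
  have e3 : 2 ^ m ≠ 0 := by positivity
  have e4 : 2 ^ (m + 1) ≠ 0 := by positivity
  simp only [kerdockEnumerator, map_add, map_mul, map_pow, MvPolynomial.eval_X, one_pow, mul_one,
    MvPolynomial.eval_C, Matrix.cons_val_zero, Matrix.cons_val_one, sub_self, zero_pow e1,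
    zero_pow e2, zero_pow e3, zero_pow e4, mul_zero, add_zero, Finset.sum_const, nsmul_eq_mul] at h1
  rw [← Set.ncard_eq_toFinset_card] at h1
  have hle : 2 * m + 2 ≤ 2 ^ (m + 1) := by
    have := Nat.lt_two_pow_self (n := m)
    rw [pow_succ]; omega
  have h4 : (4 : ℚ) ^ (m + 1) = 2 ^ (2 * m + 2) := by
    rw [show 2 * m + 2 = 2 * (m + 1) by ring, pow_mul]; norm_num
  have h5 : (2 : ℚ) ^ 2 ^ (m + 1) = 2 ^ (2 ^ (m + 1) - 2 * m - 2) * 2 ^ (2 * m + 2) := by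
    rw [← pow_add]; congr 1; omega
  have h6 : (1 + 1 : ℚ) = 2 := by norm_num
  rw [h6] at h1
  push_cast at h1
  rw [h4, h5] at h1
  have h7 : ((binaryImage D).ncard : ℚ) = 2 ^ (2 ^ (m + 1) - 2 * m - 2) := by
    rw [h1]; field_simp
  exact_mod_cast h7

/-! ### Cubic exponential sums in characteristic `2` -/

section CubicSums

lemma isPrimitive_of_apply_one {F : Type*} [Field F] {ψ : AddChar F ℤ} (h1 : ψ 1 = -1) :
    ψ.IsPrimitive := by
  apply AddChar.IsPrimitive.of_ne_one
  rintro rfl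
  norm_num at h1

variable {F : Type*} [Field F] [Fintype F]

/-- Take `(-1)^Tr`: the trace is Frobenius invariant, and `Tr 1 = 1` because the degree of `F` over
its prime field is odd. -/
lemma exists_addChar_sign [CharP F 2] (hodd : ∃ k, Fintype.card F = 2 * 4 ^ k) :
    ∃ ψ : AddChar F ℤ, ψ 1 = -1 ∧ ∀ x, ψ (x ^ 2) = ψ x := by
  obtain ⟨k, hk⟩ := hodd
  let _ : Algebra (ZMod 2) F := ZMod.algebra F 2
  let e : AddChar (ZMod 2) ℤ := AddChar.zmodChar 2 (by norm_num : (-1 : ℤ) ^ 2 = 1)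
  refine ⟨e.compAddMonoidHom (Algebra.trace (ZMod 2) F).toAddMonoidHom, ?_, fun x => ?_⟩
  · change e (Algebra.trace (ZMod 2) F 1) = -1
    have h1 : Module.finrank (ZMod 2) F = 2 * k + 1 := by
      have := Module.card_eq_pow_finrank (K := ZMod 2) (V := F)
      rw [ZMod.card, hk] at this
      apply Nat.pow_right_injective (le_refl 2)
      change 2 ^ _ = 2 ^ _
      rw [← this, pow_succ', pow_mul]
      norm_num
    have h2 : Algebra.trace (ZMod 2) F 1 = 1 := by
      rw [← map_one (algebraMap (ZMod 2) F), Algebra.trace_algebraMap, h1, nsmul_eq_mul, mul_one,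
        Nat.cast_add, Nat.cast_mul, Nat.cast_one, CharP.cast_eq_zero, zero_mul, zero_add]
    rw [h2, AddChar.zmodChar_apply]
    rfl
  · change e (Algebra.trace (ZMod 2) F (x ^ 2)) = e (Algebra.trace (ZMod 2) F x)
    have h1 := Algebra.trace_eq_of_algEquiv (FiniteField.frobeniusAlgEquiv (ZMod 2) F 2) x
    rw [← h1]
    congr 2

lemma addChar_sign {F : Type*} [Field F] [CharP F 2] (ψ : AddChar F ℤ) (x : F) :
    ψ x = 1 ∨ ψ x = -1 := by
  rw [← mul_self_eq_one_iff, ← AddChar.map_add_eq_mul, CharTwo.add_self_eq_zero,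
    AddChar.map_zero_eq_one]

/-- The exponential sum of the cubic polynomial `a x + c x³`. -/
def cubicSum (ψ : AddChar F ℤ) (a c : F) : ℤ := ∑ x, ψ (a * x + c * x ^ 3)

/-- The order `2·4ᵏ - 1` of the multiplicative group is `1` modulo `3`. -/
lemma pow_three_eq_one {k : ℕ} (hk : Fintype.card F = 2 * 4 ^ k) {d : F} (hd : d ^ 3 = 1) :
    d = 1 := by
  have hd0 : d ≠ 0 := by
    rintro rfl
    norm_num at hd
  have h1 := FiniteField.pow_card_sub_one_eq_one d hd0
  obtain ⟨t, ht⟩ : ∃ t, 2 * 4 ^ k - 1 = 3 * t + 1 := by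
    have h3 : 4 ^ k % 3 = 1 := by rw [Nat.pow_mod]; simp
    exact ⟨(2 * 4 ^ k - 1) / 3, by omega⟩
  rwa [hk, ht, pow_succ, pow_mul, hd, one_pow, one_mul] at h1

lemma exists_cube_eq {k : ℕ} (hk : Fintype.card F = 2 * 4 ^ k) (c : F) : ∃ e, e ^ 3 = c := by
  have hinj : Function.Injective fun x : F => x ^ 3 := by
    intro x y hxy
    change x ^ 3 = y ^ 3 at hxy
    by_cases hy : y = 0
    · rw [hy, zero_pow three_ne_zero] at hxy
      rw [hy, pow_eq_zero_iff three_ne_zero |>.mp hxy]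
    · have : (x / y) ^ 3 = 1 := by rw [div_pow, hxy, div_self (pow_ne_zero _ hy)]
      exact (div_eq_one_iff_eq hy).mp (pow_three_eq_one hk this)
  exact (Finite.injective_iff_surjective.mp hinj) c

variable {ψ : AddChar F ℤ}

/-- The substitution `x ↦ ex` normalises the cubic coefficient; every coefficient is a cube by
`exists_cube_eq`. -/
lemma cubicSum_mul_cube {e : F} (he : e ≠ 0) (a : F) :
    cubicSum ψ a (e ^ 3) = cubicSum ψ (a / e) 1 := by
  rw [cubicSum, cubicSum, ← Equiv.sum_comp (Equiv.mulLeft₀ e he)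
    (fun x => ψ (a / e * x + 1 * x ^ 3))]
  refine Finset.sum_congr rfl fun x _ => ?_
  rw [Equiv.mulLeft₀_apply]
  congr 1
  field_simp

lemma cubicSum_zero_right [DecidableEq F] (h1 : ψ 1 = -1) (a : F) :
    cubicSum ψ a 0 = if a = 0 then (Fintype.card F : ℤ) else 0 := by
  have := AddChar.sum_mulShift a (isPrimitive_of_apply_one h1)
  rw [cubicSum]
  simp only [zero_mul, add_zero, mul_comm a]
  rw [this]
  split_ifs <;> simp

lemma sum_cubicSum (h1 : ψ 1 = -1) (c : F) : ∑ a, cubicSum ψ a c = Fintype.card F := by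
  classical
  simp_rw [cubicSum]
  rw [Finset.sum_comm]
  have : ∀ x : F, ∑ a, ψ (a * x + c * x ^ 3) = if x = 0 then (Fintype.card F : ℤ) else 0 := by
    intro x
    simp_rw [AddChar.map_add_eq_mul]
    rw [← Finset.sum_mul, AddChar.sum_mulShift x (isPrimitive_of_apply_one h1)]
    split_ifs with hx
    · rw [hx, zero_pow three_ne_zero, mul_zero, AddChar.map_zero_eq_one, mul_one]
    · simp
  simp [this]

variable [CharP F 2]

/-- In the square put the second variable equal to `x + d`: the exponent becomes `ad + d³ + x²d +
xd²`. Invariance of `ψ` under squaring replaces `x²d + xd²` by `x²(d + d⁴)`, so the sum over `x`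
vanishes unless `d` is `0` or `1`. These two terms contribute `1` and `ψ(a + 1) = -ψ(a)`. -/
lemma cubicSum_one_sq {k : ℕ} (hk : Fintype.card F = 2 * 4 ^ k) (h1 : ψ 1 = -1)
    (hψ : ∀ x, ψ (x ^ 2) = ψ x) (a : F) :
    cubicSum ψ a 1 ^ 2 = Fintype.card F * (1 - ψ a) := by
  classical
  have h2 : (2 : F) = 0 := CharTwo.two_eq_zero
  have hinner : ∀ d : F, ∑ x, ψ (x ^ 2 * d + x * d ^ 2) =
      if d = 0 ∨ d = 1 then (Fintype.card F : ℤ) else 0 := by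
    intro d
    have e1 : ∀ x, ψ (x ^ 2 * d + x * d ^ 2) = ψ (frobenius F 2 x * (d + d ^ 4)) := by
      intro x
      rw [AddChar.map_add_eq_mul, ← hψ (x * d ^ 2), ← AddChar.map_add_eq_mul, frobenius_def]
      congr 1; ring
    have hbij : Function.Bijective (frobenius F 2) :=
      Finite.injective_iff_bijective.mp (frobenius_inj F 2)
    rw [Finset.sum_congr rfl fun x _ => e1 x,
      hbij.sum_comp (fun x => ψ (x * (d + d ^ 4))),
      AddChar.sum_mulShift _ (isPrimitive_of_apply_one h1)]
    have hiff : d + d ^ 4 = 0 ↔ d = 0 ∨ d = 1 := by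
      constructor
      · intro h0
        have : d * (d ^ 3 - 1) = 0 := by linear_combination h0 - d * h2
        exact (mul_eq_zero.mp this).imp_right fun h => pow_three_eq_one hk (sub_eq_zero.mp h)
      · rintro (rfl | rfl)
        · ring
        · linear_combination h2
    simp only [hiff]
    split_ifs <;> simp
  have hsq : cubicSum ψ a 1 ^ 2 =
      ∑ d, ψ (a * d + d ^ 3) * ∑ x, ψ (x ^ 2 * d + x * d ^ 2) := by
    rw [sq, cubicSum, Finset.sum_mul_sum]
    simp_rw [Finset.mul_sum]
    rw [Finset.sum_comm (s := Finset.univ (α := F)) (t := Finset.univ (α := F))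
      (f := fun d x => ψ (a * d + d ^ 3) * ψ (x ^ 2 * d + x * d ^ 2))]
    refine Finset.sum_congr rfl fun x _ => ?_
    rw [← Equiv.sum_comp (Equiv.addLeft x)]
    refine Finset.sum_congr rfl fun d _ => ?_
    rw [← AddChar.map_add_eq_mul, ← AddChar.map_add_eq_mul, Equiv.coe_addLeft]
    congr 1
    linear_combination (a * x + x ^ 3 + x ^ 2 * d + x * d ^ 2) * h2
  rw [hsq]
  simp_rw [hinner, mul_ite, mul_zero]
  rw [← Finset.sum_filter]
  have hset : Finset.filter (fun d : F => d = 0 ∨ d = 1) Finset.univ = {0, 1} := by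
    ext d; simp
  rw [hset, Finset.sum_pair zero_ne_one]
  have e0 : ψ (a * 0 + 0 ^ 3) = 1 := by
    rw [mul_zero, zero_pow three_ne_zero, add_zero, AddChar.map_zero_eq_one]
  rw [e0, mul_one, one_pow, AddChar.map_add_eq_mul, h1]
  ring

/-- If the cubic sum at `a + b` does not vanish, then exactly one of the sums at `a` and `b`
vanishes. -/
lemma cubicSum_trichotomy {k : ℕ} (hk : Fintype.card F = 2 * 4 ^ k) (h1 : ψ 1 = -1)
    (hψ : ∀ x, ψ (x ^ 2) = ψ x) {c : F} (hc : c ≠ 0) (a b : F) :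
    cubicSum ψ (a + b) c = 0 ∨
      (cubicSum ψ a c = 0 ∧ cubicSum ψ b c ^ 2 = (2 * 2 ^ k) ^ 2) ∨
      (cubicSum ψ b c = 0 ∧ cubicSum ψ a c ^ 2 = (2 * 2 ^ k) ^ 2) := by
  obtain ⟨e, rfl⟩ := exists_cube_eq hk c
  have he : e ≠ 0 := by
    rintro rfl
    exact hc (zero_pow three_ne_zero)
  have hq : ((2 : ℤ) * 2 ^ k) ^ 2 = (Fintype.card F : ℤ) * 2 := by
    rw [hk, mul_pow, ← pow_mul, mul_comm k 2, pow_mul]; push_cast; ring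
  -- Each square is `q(1 - ψ(a/e))`, that is `0` or `2q`. If the sum at `a + b` is nonzero then
  -- `ψ(a/e)ψ(b/e) = -1`, so exactly one of the two signs is `1`.
  have hG := fun a => (cubicSum_mul_cube (ψ := ψ) he a) ▸ cubicSum_one_sq hk h1 hψ (a / e)
  have ha := hG a
  have hb := hG b
  have hab := hG (a + b)
  rw [add_div, AddChar.map_add_eq_mul] at hab
  rw [hq]
  rcases addChar_sign ψ (a / e) with ea | ea <;> rcases addChar_sign ψ (b / e) with eb | eb <;>
    rw [ea] at ha hab <;> rw [eb] at hb hab <;> norm_num at ha hb hab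
  · exact Or.inl hab
  · exact Or.inr (Or.inl ⟨ha, hb⟩)
  · exact Or.inr (Or.inr ⟨hb, ha⟩)
  · exact Or.inl hab

/-- The Fourier expansion of the Preparata conditions. -/
lemma sum_cubicSum_mul [DecidableEq F] (h1 : ψ 1 = -1) (A B A' B' : F) :
    ∑ c, ∑ a, ∑ b, cubicSum ψ (a + b) c * ψ (a * A + c * A') * ψ (b * B + c * B') =
      if A = B ∧ A' + A ^ 3 = B' then (Fintype.card F : ℤ) ^ 3 else 0 := by
  have hsum : ∀ z : F, ∑ x, ψ (x * z) = if z = 0 then (Fintype.card F : ℤ) else 0 := by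
    intro z
    rw [AddChar.sum_mulShift z (isPrimitive_of_apply_one h1)]
    split_ifs <;> simp
  -- Here `s` is the summation variable of the cubic sum. The sums over `a` and `b` force `s = A`
  -- and `s = B`; the sum over `c` then imposes the cubic condition.
  have hexp : ∑ c, ∑ a, ∑ b, cubicSum ψ (a + b) c * ψ (a * A + c * A') * ψ (b * B + c * B') =
      ∑ s, (∑ c, ψ (c * (s ^ 3 + A' + B'))) * (∑ a, ψ (a * (s + A))) *
        ∑ b, ψ (b * (s + B)) := by
    have : ∀ s, (∑ c, ψ (c * (s ^ 3 + A' + B'))) * (∑ a, ψ (a * (s + A))) *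
        ∑ b, ψ (b * (s + B)) = ∑ c, ∑ a, ∑ b,
          ψ ((a + b) * s + c * s ^ 3) * ψ (a * A + c * A') * ψ (b * B + c * B') := by
      intro s
      rw [Finset.sum_mul_sum, Finset.sum_mul]
      refine Finset.sum_congr rfl fun c _ => ?_
      rw [Finset.sum_mul_sum]
      refine Finset.sum_congr rfl fun a _ => Finset.sum_congr rfl fun b _ => ?_
      simp only [← AddChar.map_add_eq_mul]
      congr 1; ring
    symm
    rw [Finset.sum_congr rfl fun s _ => this s, Finset.sum_comm]
    refine Finset.sum_congr rfl fun c _ => ?_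
    rw [Finset.sum_comm]
    refine Finset.sum_congr rfl fun a _ => ?_
    rw [Finset.sum_comm]
    refine Finset.sum_congr rfl fun b _ => ?_
    rw [cubicSum, Finset.sum_mul, Finset.sum_mul]
  rw [hexp]
  simp_rw [hsum, CharTwo.add_eq_zero]
  rw [Finset.sum_eq_single A]
  · rw [if_pos rfl]
    simp only [add_comm (A ^ 3) A']
    rw [ite_and]
    split_ifs
    · rw [pow_three']
    all_goals simp
  · intro s _ hs
    rw [if_neg hs, mul_zero, zero_mul]
  · simp

end CubicSums
/-! ### The weight enumerator of the Preparata code -/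

/-- The number of plus signs is half of the number of factors plus the sum of the signs, so the
product depends only on `∑ κ`. -/
lemma prod_add_sign_mul {ι : Type*} [Fintype ι] (κ : ι → ℤ) (hκ : ∀ i, κ i = 1 ∨ κ i = -1)
    (x y : ℚ) :
    ∏ i, (x + κ i * y) = (x + y) ^ ((Fintype.card ι + ∑ i, κ i) / 2).toNat *
      (x - y) ^ ((Fintype.card ι - ∑ i, κ i) / 2).toNat := by
  classical
  have h1 : ∀ i, x + κ i * y = if κ i = 1 then x + y else x - y := by
    intro i
    rcases hκ i with h | h <;> rw [h] <;> norm_num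
    ring
  have h2 : ∀ i, κ i = (if κ i = 1 then 1 else 0) - if ¬κ i = 1 then 1 else 0 := by
    intro i
    rcases hκ i with h | h <;> rw [h] <;> norm_num
  have h3 : ∑ i, κ i = Finset.card {i | κ i = 1} - Finset.card {i | ¬κ i = 1} := by
    rw [Finset.sum_congr rfl fun i _ => h2 i, Finset.sum_sub_distrib, Finset.sum_boole,
      Finset.sum_boole]
  have h4 := Finset.card_filter_add_card_filter_not (s := (Finset.univ : Finset ι))
    (fun i => κ i = 1)
  rw [Finset.card_univ] at h4
  rw [Finset.prod_congr rfl fun i _ => h1 i, Finset.prod_ite, Finset.prod_const,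
    Finset.prod_const]
  congr 2 <;> omega

lemma pow_mul_pow_hammingNorm {ι A : Type*} [Fintype ι] [CommRing A] (x y : A)
    (u : ι → ZMod 2) :
    x ^ (Fintype.card ι - hammingNorm u) * y ^ hammingNorm u =
      ∏ i, if u i = 1 then y else x := by
  have h1 : ∀ i, u i ≠ 0 ↔ u i = 1 := fun i => by
    generalize u i = z; revert z; decide
  have h4 := Finset.card_filter_add_card_filter_not (s := (Finset.univ : Finset ι))
    (fun i => u i = 1)
  rw [Finset.card_univ] at h4
  have h5 : hammingNorm u = Finset.card {i | u i = 1} := by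
    rw [hammingNorm]; simp only [h1]
  rw [Finset.prod_ite, Finset.prod_const, Finset.prod_const, h5, mul_comm]
  congr 2
  omega

lemma sum_sign_pow (n : ℕ) :
    ∑ σ ∈ ({1, -1} : Finset ℤ), σ ^ n = if Even n then 2 else 0 := by
  rw [Finset.sum_pair (by norm_num), one_pow]
  split_ifs with hn
  · rw [hn.neg_one_pow]; norm_num
  · rw [(Nat.not_even_iff_odd.mp hn).neg_one_pow]; norm_num

section Preparata

variable {F : Type*} [Field F] [Fintype F]

/-- The signs by which the coordinates of the Fourier transform of the Preparata code are
twisted. -/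
def twist (ψ : AddChar F ℤ) (σ τ : ℤ) (a b c : F) : F ⊕ F → ℤ :=
  Sum.elim (fun x => σ * ψ (a * x + c * x ^ 3)) fun y => τ * ψ (b * y + c * y ^ 3)

lemma sum_twist (ψ : AddChar F ℤ) (σ τ : ℤ) (a b c : F) :
    ∑ i, twist ψ σ τ a b c i = σ * cubicSum ψ a c + τ * cubicSum ψ b c := by
  simp only [Fintype.sum_sum_type, twist, Sum.elim_inl, Sum.elim_inr, cubicSum, Finset.mul_sum]

lemma prod_ite_eq_pow_mul [DecidableEq F] (ψ : AddChar F ℤ) (σ : ℤ) (a c : F)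
    (u : F → ZMod 2) :
    ∏ x, (if u x = 1 then σ * ψ (a * x + c * x ^ 3) else 1) =
      σ ^ (Finset.card {x | u x = 1}) *
        ψ (a * ∑ x with u x = 1, x + c * ∑ x with u x = 1, x ^ 3) := by
  have hprod : ∀ (s : Finset F) (f : F → F), ψ (∑ x ∈ s, f x) = ∏ x ∈ s, ψ (f x) := fun s f =>
    map_prod ψ.toMonoidHom (fun i => Multiplicative.ofAdd (f i)) s
  rw [← Finset.prod_filter, Finset.prod_mul_distrib, Finset.prod_const, Finset.mul_sum,
    Finset.mul_sum, ← Finset.sum_add_distrib, hprod]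

variable [CharP F 2] {ψ : AddChar F ℤ}

-- The sums over `σ` and `τ` detect that `|S|` and `|T|` are even; those over `a`, `b`, `c` detect
-- the two field equations.
open Classical in
lemma sum_prod_twist (h1 : ψ 1 = -1) (u : F ⊕ F → ZMod 2) :
    ∑ c, ∑ a, ∑ b, ∑ σ ∈ ({1, -1} : Finset ℤ), ∑ τ ∈ ({1, -1} : Finset ℤ),
      cubicSum ψ (a + b) c * ∏ i, (if u i = 1 then twist ψ σ τ a b c i else 1) =
      if u ∈ preparataCode F then 4 * (Fintype.card F : ℤ) ^ 3 else 0 := by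
  set S : Finset F := {x | u (Sum.inl x) = 1} with hS
  set T : Finset F := {y | u (Sum.inr y) = 1} with hT
  have hmem : u ∈ preparataCode F ↔ (Even S.card ∧ Even T.card) ∧
      ∑ x ∈ S, x = ∑ y ∈ T, y ∧ ∑ x ∈ S, x ^ 3 + (∑ x ∈ S, x) ^ 3 = ∑ y ∈ T, y ^ 3 := by
    rw [and_assoc]
    exact Iff.rfl
  have hterm : ∀ c a b : F, ∑ σ ∈ ({1, -1} : Finset ℤ), ∑ τ ∈ ({1, -1} : Finset ℤ),
      cubicSum ψ (a + b) c * ∏ i, (if u i = 1 then twist ψ σ τ a b c i else 1) =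
      ((∑ σ ∈ ({1, -1} : Finset ℤ), σ ^ S.card) * ∑ τ ∈ ({1, -1} : Finset ℤ), τ ^ T.card) *
      (cubicSum ψ (a + b) c * ψ (a * ∑ x ∈ S, x + c * ∑ x ∈ S, x ^ 3) *
        ψ (b * ∑ y ∈ T, y + c * ∑ y ∈ T, y ^ 3)) := by
    intro c a b
    rw [Finset.sum_mul_sum, Finset.sum_mul]
    refine Finset.sum_congr rfl fun σ _ => ?_
    rw [Finset.sum_mul]
    refine Finset.sum_congr rfl fun τ _ => ?_
    rw [Fintype.prod_sum_type]
    simp only [twist, Sum.elim_inl, Sum.elim_inr]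
    rw [prod_ite_eq_pow_mul ψ σ a c fun x => u (Sum.inl x),
      prod_ite_eq_pow_mul ψ τ b c fun x => u (Sum.inr x)]
    ring
  simp_rw [hterm, ← Finset.mul_sum]
  rw [sum_cubicSum_mul h1, sum_sign_pow, sum_sign_pow]
  simp only [hmem, ite_and]
  split_ifs <;> ring

open Classical in
/-- The weight enumerator of the Preparata code in terms of cubic sums. -/
lemma eval_weightEnumerator_preparataCode (h1 : ψ 1 = -1) (x y : ℚ) :
    4 * (Fintype.card F : ℚ) ^ 3 *
      MvPolynomial.eval ![x, y] (weightEnumerator (preparataCode F)) =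
      ∑ c, ∑ a, ∑ b, ∑ σ ∈ ({1, -1} : Finset ℤ), ∑ τ ∈ ({1, -1} : Finset ℤ),
        (cubicSum ψ (a + b) c : ℚ) * ∏ i, (x + twist ψ σ τ a b c i * y) := by
  have hW : MvPolynomial.eval ![x, y] (weightEnumerator (preparataCode F)) =
      ∑ u : F ⊕ F → ZMod 2, if u ∈ preparataCode F then ∏ i, (if u i = 1 then y else x)
        else 0 := by
    rw [weightEnumerator, map_sum, ← Finset.sum_filter]
    refine Finset.sum_congr ?_ fun u _ => ?_
    · ext u; simp
    · simp only [map_mul, map_pow, MvPolynomial.eval_X, Matrix.cons_val_zero, Matrix.cons_val_one]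
      rw [pow_mul_pow_hammingNorm]
  have hprod : ∀ κ : F ⊕ F → ℤ, ∏ i, (x + κ i * y) =
      ∑ u : F ⊕ F → ZMod 2, ((∏ i, (if u i = 1 then κ i else 1) : ℤ) : ℚ) *
        ∏ i, (if u i = 1 then y else x) := by
    intro κ
    have hi : ∀ i, x + κ i * y = ∑ z : ZMod 2, ((if z = 1 then κ i else 1 : ℤ) : ℚ) *
        (if z = 1 then y else x) := by
      intro i
      have hu : (Finset.univ : Finset (ZMod 2)) = {0, 1} := by decide
      rw [hu, Finset.sum_pair (by decide), if_neg (by decide), if_neg (by decide), if_pos rfl,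
        if_pos rfl, Int.cast_one, one_mul]
    rw [Finset.prod_congr rfl fun i _ => hi i, Finset.prod_univ_sum, Fintype.piFinset_univ]
    refine Finset.sum_congr (by congr!) fun u _ => ?_
    rw [Finset.prod_mul_distrib, Int.cast_prod]
  have hind : ∀ u : F ⊕ F → ZMod 2,
      4 * (Fintype.card F : ℚ) ^ 3 * (if u ∈ preparataCode F then ∏ i, (if u i = 1 then y else x)
        else 0) = ((∑ c, ∑ a, ∑ b, ∑ σ ∈ ({1, -1} : Finset ℤ), ∑ τ ∈ ({1, -1} : Finset ℤ),
      cubicSum ψ (a + b) c * ∏ i, (if u i = 1 then twist ψ σ τ a b c i else 1) : ℤ) : ℚ) *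
        ∏ i, (if u i = 1 then y else x) := by
    intro u
    rw [sum_prod_twist h1]
    split_ifs
    · push_cast; ring
    · push_cast; ring
  rw [hW, Finset.mul_sum, Finset.sum_congr rfl fun u _ => hind u]
  simp only [hprod, Int.cast_sum, Finset.sum_mul, Finset.mul_sum]
  rw [Finset.sum_comm]
  refine Finset.sum_congr rfl fun c _ => ?_
  rw [Finset.sum_comm]
  refine Finset.sum_congr rfl fun a _ => ?_
  rw [Finset.sum_comm]
  refine Finset.sum_congr rfl fun b _ => ?_
  rw [Finset.sum_comm]
  refine Finset.sum_congr rfl fun σ _ => ?_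
  rw [Finset.sum_comm]
  refine Finset.sum_congr rfl fun τ _ => Finset.sum_congr rfl fun u _ => ?_
  push_cast
  ring

/-- For `c = 0` the sum at `a + b` is `q` if `a = b` and `0` otherwise. For `c ≠ 0` the trichotomy
makes the sum over the signs the same for all `(a, b)` with nonzero coefficient, and the
coefficients add up to `q²`. -/
lemma sum_cubicSum_transform {k : ℕ} (hk : Fintype.card F = 2 * 4 ^ k) (h1 : ψ 1 = -1)
    (hψ : ∀ x, ψ (x ^ 2) = ψ x) (T : ℤ → ℚ) :
    ∑ c, ∑ a, ∑ b, ∑ σ ∈ ({1, -1} : Finset ℤ), ∑ τ ∈ ({1, -1} : Finset ℤ),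
        (cubicSum ψ (a + b) c : ℚ) * T (σ * cubicSum ψ a c + τ * cubicSum ψ b c) =
      Fintype.card F * (T (2 * Fintype.card F) + T (-(2 * Fintype.card F)) +
        (4 * Fintype.card F - 2) * T 0) +
      (Fintype.card F - 1) * ((Fintype.card F : ℚ) ^ 2 *
        (2 * (T (2 * 2 ^ k) + T (-(2 * 2 ^ k))))) := by
  classical
  set q := Fintype.card F with hq
  have hU : ∀ g h n : ℤ, ∑ σ ∈ ({1, -1} : Finset ℤ), ∑ τ ∈ ({1, -1} : Finset ℤ),
      (n : ℚ) * T (σ * g + τ * h) =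
        n * (T (g + h) + T (g - h) + T (-g + h) + T (-g - h)) := by
    intro g h n
    rw [Finset.sum_pair (by norm_num), Finset.sum_pair (by norm_num),
      Finset.sum_pair (by norm_num)]
    simp only [one_mul, neg_one_mul, ← sub_eq_add_neg]
    ring
  have hzero : ∑ a, ∑ b, ∑ σ ∈ ({1, -1} : Finset ℤ), ∑ τ ∈ ({1, -1} : Finset ℤ),
        (cubicSum ψ (a + b) 0 : ℚ) * T (σ * cubicSum ψ a 0 + τ * cubicSum ψ b 0) =
      q * (T (2 * q) + T (-(2 * q)) + (4 * q - 2) * T 0) := by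
    simp only [hU, cubicSum_zero_right h1, CharTwo.add_eq_zero]
    have hb : ∀ a : F, ∑ b : F, (((if a = b then (q : ℤ) else 0 : ℤ) : ℚ)) *
        (T ((if a = 0 then (q : ℤ) else 0) + (if b = 0 then (q : ℤ) else 0)) +
          T ((if a = 0 then (q : ℤ) else 0) - (if b = 0 then (q : ℤ) else 0)) +
          T (-(if a = 0 then (q : ℤ) else 0) + (if b = 0 then (q : ℤ) else 0)) +
          T (-(if a = 0 then (q : ℤ) else 0) - (if b = 0 then (q : ℤ) else 0))) =
        4 * q * T 0 + if a = 0 then q * (T (2 * q) + T (-(2 * q)) - 2 * T 0) else 0 := by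
      intro a
      rw [Finset.sum_eq_single a]
      · rw [if_pos rfl]
        split_ifs
        · have e1 : (q : ℤ) + q = 2 * q := by ring
          have e2 : -(q : ℤ) - q = -(2 * q) := by ring
          rw [e1, e2, sub_self, neg_add_cancel]
          push_cast; ring
        · simp only [add_zero, sub_zero, neg_zero]
          push_cast; ring
      · intro b _ hb
        rw [if_neg (Ne.symm hb), Int.cast_zero, zero_mul]
      · simp
    rw [Finset.sum_congr rfl fun a _ => hb a, Finset.sum_add_distrib, Finset.sum_const,
      Finset.card_univ, ← hq, Finset.sum_ite_eq' Finset.univ (0 : F), if_pos (Finset.mem_univ _),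
      nsmul_eq_mul]
    ring
  have hne : ∀ c : F, c ≠ 0 →
      ∑ a, ∑ b, ∑ σ ∈ ({1, -1} : Finset ℤ), ∑ τ ∈ ({1, -1} : Finset ℤ),
        (cubicSum ψ (a + b) c : ℚ) * T (σ * cubicSum ψ a c + τ * cubicSum ψ b c) =
      (q : ℚ) ^ 2 * (2 * (T (2 * 2 ^ k) + T (-(2 * 2 ^ k)))) := by
    intro c hc
    have hab : ∀ a b : F, ∑ σ ∈ ({1, -1} : Finset ℤ), ∑ τ ∈ ({1, -1} : Finset ℤ),
        (cubicSum ψ (a + b) c : ℚ) * T (σ * cubicSum ψ a c + τ * cubicSum ψ b c) =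
        (cubicSum ψ (a + b) c : ℚ) * (2 * (T (2 * 2 ^ k) + T (-(2 * 2 ^ k)))) := by
      intro a b
      rw [hU]
      rcases cubicSum_trichotomy hk h1 hψ hc a b with h0 | ⟨ha, hb⟩ | ⟨hb, ha⟩
      · rw [h0, Int.cast_zero, zero_mul, zero_mul]
      · rw [ha]
        rcases sq_eq_sq_iff_eq_or_eq_neg.mp hb with hb | hb <;> rw [hb] <;>
          simp only [zero_add, zero_sub, neg_zero, neg_neg] <;> ring
      · rw [hb]
        rcases sq_eq_sq_iff_eq_or_eq_neg.mp ha with ha | ha <;> rw [ha] <;>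
          simp only [add_zero, sub_zero, neg_neg] <;> ring
    have hsum : ∑ a : F, ∑ b : F, (cubicSum ψ (a + b) c : ℚ) = (q : ℚ) ^ 2 := by
      have h2 : ∀ a : F, ∑ b : F, (cubicSum ψ (a + b) c : ℚ) = q := by
        intro a
        refine (Equiv.sum_comp (Equiv.addLeft a) (fun b => (cubicSum ψ b c : ℚ))).trans ?_
        rw [← Int.cast_sum, sum_cubicSum h1, Int.cast_natCast]
      rw [Finset.sum_congr rfl fun a _ => h2 a, Finset.sum_const, Finset.card_univ, nsmul_eq_mul,
        sq]
    rw [Finset.sum_congr rfl fun a _ => Finset.sum_congr rfl fun b _ => hab a b]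
    simp_rw [← Finset.sum_mul]
    rw [hsum]
  rw [← Finset.add_sum_erase _ _ (Finset.mem_univ (0 : F)), hzero,
    Finset.sum_congr rfl fun c hc => hne c (Finset.ne_of_mem_erase hc), Finset.sum_const,
    Finset.card_erase_of_mem (Finset.mem_univ _), Finset.card_univ, nsmul_eq_mul, ← hq,
    Nat.cast_sub (by rw [hq]; exact Fintype.card_pos), Nat.cast_one]

/-- The weight enumerator of the Preparata code is the MacWilliams transform of the Kerdock weight
enumerator. -/
theorem weightEnumerator_preparataCode {m : ℕ} (hodd : Odd m)
    (hF : Fintype.card F = 2 ^ m) :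
    weightEnumerator (preparataCode F) = macWilliams (4 ^ (m + 1)) (kerdockEnumerator m) := by
  obtain ⟨k, hm⟩ := hodd
  have hk : Fintype.card F = 2 * 4 ^ k := by
    rw [hF, hm, pow_succ, pow_mul]; ring
  obtain ⟨ψ, h1, hψ⟩ := exists_addChar_sign (F := F) ⟨k, hk⟩
  apply MvPolynomial.funext
  intro v
  rw [eval_macWilliams]
  have hv : v = ![v 0, v 1] := by ext i; fin_cases i <;> rfl
  have hsign : ∀ σ ∈ ({1, -1} : Finset ℤ), ∀ z, σ * ψ z = 1 ∨ σ * ψ z = -1 := by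
    intro σ hσ z
    rw [Finset.mem_insert, Finset.mem_singleton] at hσ
    rcases hσ with rfl | rfl <;> rcases addChar_sign ψ z with h | h <;> rw [h] <;> norm_num
  let T : ℤ → ℚ := fun s => (v 0 + v 1) ^ ((2 ^ (m + 1) + s) / 2).toNat *
    (v 0 - v 1) ^ ((2 ^ (m + 1) - s) / 2).toNat
  have hT : ∀ s, T s = (v 0 + v 1) ^ ((2 ^ (m + 1) + s) / 2).toNat *
    (v 0 - v 1) ^ ((2 ^ (m + 1) - s) / 2).toNat := fun _ => rfl
  have hprod : ∀ c a b : F, ∀ σ ∈ ({1, -1} : Finset ℤ), ∀ τ ∈ ({1, -1} : Finset ℤ),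
      ∏ i, (v 0 + twist ψ σ τ a b c i * v 1) =
        T (σ * cubicSum ψ a c + τ * cubicSum ψ b c) := by
    intro c a b σ hσ τ hτ
    rw [prod_add_sign_mul, sum_twist, Fintype.card_sum, hF, hT]
    · push_cast; rw [pow_succ, mul_two]
    · rintro (x | y)
      · exact hsign σ hσ _
      · exact hsign τ hτ _
  have hE := eval_weightEnumerator_preparataCode h1 (v 0) (v 1)
  have hS : ∑ c : F, ∑ a, ∑ b, ∑ σ ∈ ({1, -1} : Finset ℤ), ∑ τ ∈ ({1, -1} : Finset ℤ),
        (cubicSum ψ (a + b) c : ℚ) * ∏ i, (v 0 + twist ψ σ τ a b c i * v 1) =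
      ∑ c, ∑ a, ∑ b, ∑ σ ∈ ({1, -1} : Finset ℤ), ∑ τ ∈ ({1, -1} : Finset ℤ),
        (cubicSum ψ (a + b) c : ℚ) * T (σ * cubicSum ψ a c + τ * cubicSum ψ b c) :=
    Finset.sum_congr rfl fun c _ => Finset.sum_congr rfl fun a _ => Finset.sum_congr rfl fun b _ =>
      Finset.sum_congr rfl fun σ hσ => Finset.sum_congr rfl fun τ hτ => by
        rw [hprod c a b σ hσ τ hτ]
  rw [hS, sum_cubicSum_transform hk h1 hψ T, hF, ← hv] at hE
  have hk2 : (m - 1) / 2 = k := by omega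
  have hkm : (2 : ℕ) ^ k ≤ 2 ^ m := Nat.pow_le_pow_right (by norm_num) (by omega)
  have c1 : ((2 ^ m : ℕ) : ℤ) = 2 ^ m := by push_cast; rfl
  have c2 : ((2 ^ k : ℕ) : ℤ) = 2 ^ k := by push_cast; rfl
  have c3 : (0 : ℤ) < 2 ^ m := by positivity
  have c4 : (0 : ℤ) < 2 ^ k := by positivity
  have t1 : T (2 * (2 ^ m : ℕ)) = (v 0 + v 1) ^ 2 ^ (m + 1) := by
    have e : ((2 ^ (m + 1) - 2 * (2 ^ m : ℕ) : ℤ) / 2).toNat = 0 := by omega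
    rw [hT, e, pow_zero, mul_one]; congr 1; omega
  have t2 : T (-(2 * (2 ^ m : ℕ))) = (v 0 - v 1) ^ 2 ^ (m + 1) := by
    have e : ((2 ^ (m + 1) + -(2 * (2 ^ m : ℕ)) : ℤ) / 2).toNat = 0 := by omega
    rw [hT, e, pow_zero, one_mul]; congr 1; omega
  have t3 : T 0 = (v 0 + v 1) ^ 2 ^ m * (v 0 - v 1) ^ 2 ^ m := by
    rw [hT]; congr 2 <;> omega
  have t4 : T (2 * 2 ^ k) = (v 0 + v 1) ^ (2 ^ m + 2 ^ k) * (v 0 - v 1) ^ (2 ^ m - 2 ^ k) := by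
    rw [hT]; congr 2 <;> omega
  have t5 : T (-(2 * 2 ^ k)) =
      (v 0 + v 1) ^ (2 ^ m - 2 ^ k) * (v 0 - v 1) ^ (2 ^ m + 2 ^ k) := by
    rw [hT]; congr 2 <;> omega
  rw [t1, t2, t3, t4, t5] at hE
  have hq : (2 : ℚ) ^ m ≠ 0 := by positivity
  have h4 : ((4 ^ (m + 1) : ℕ) : ℚ) = 4 * (2 ^ m) ^ 2 := by
    push_cast
    rw [pow_succ, ← pow_mul, mul_comm m 2, pow_mul]
    norm_num
    ring
  rw [h4, one_div, eq_inv_mul_iff_mul_eq₀ (by positivity)]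
  -- The expansion carries `4q³`, one factor `q` more than the `4q² = 4ᵐ⁺¹` of the MacWilliams
  -- transform.
  apply mul_left_cancel₀ hq
  simp only [kerdockEnumerator, hk2, map_add, map_mul, map_pow, MvPolynomial.eval_X,
    MvPolynomial.eval_C, Matrix.cons_val_zero, Matrix.cons_val_one]
  push_cast at hE
  rw [pow_succ 2 m, pow_succ 2 (m + 1), pow_succ 2 m] at *
  linear_combination hE

end Preparata
end Z4Code

theorem theorem6 (m : ℕ) (hm : 2 ≤ m) (h₂ : (ZMod 2)[X])
    (hh₂ : Z4Code.IsPrimitiveIrreducible m h₂) (h : (ZMod 4)[X]) (hh : Z4Code.IsLift m h₂ h) :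
    Z4Code.codeH m h = Z4Code.dual (Z4Code.codeD m h) ∧
    (Odd m → 3 ≤ m →
      let K := Z4Code.binaryImage (Z4Code.codeD m h)
      let P := Z4Code.binaryImage (Z4Code.codeH m h)
      Z4Code.length P = 2 ^ (m + 1) ∧
      P.ncard = 2 ^ (2 ^ (m + 1) - 2 * m - 2) ∧
      Z4Code.HasMinDistance P 6 ∧
      Z4Code.DistanceInvariant P ∧ Z4Code.DistanceInvariant K ∧
      (∀ (F : Type) [Field F] [Fintype F], Fintype.card F = 2 ^ m →
        Z4Code.weightEnumerator P = Z4Code.weightEnumerator (Z4Code.preparataCode F)) ∧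
      Z4Code.weightEnumerator P =
        Z4Code.macWilliams K.ncard (Z4Code.weightEnumerator K) ∧
      Z4Code.weightEnumerator P =
        Z4Code.macWilliams (4 ^ (m + 1)) (Z4Code.kerdockEnumerator m)) := by
  refine ⟨Z4Code.codeH_eq_dual hm hh₂ hh, fun hodd hm3 => ?_⟩
  have hK := Z4Code.weightEnumerator_codeD hm hodd hh₂ hh
  have hP : Z4Code.weightEnumerator (Z4Code.binaryImage (Z4Code.codeH m h)) =
      Z4Code.macWilliams (Z4Code.binaryImage (Z4Code.codeD m h)).ncard
        (Z4Code.weightEnumerator (Z4Code.binaryImage (Z4Code.codeD m h))) := by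
    rw [Z4Code.codeH_eq_dual hm hh₂ hh]
    exact Z4Code.weightEnumerator_binaryImage_dual _
  have hP' : Z4Code.weightEnumerator (Z4Code.binaryImage (Z4Code.codeH m h)) =
      Z4Code.macWilliams (4 ^ (m + 1)) (Z4Code.kerdockEnumerator m) := by
    rw [hP, hK, Z4Code.ncard_binaryImage, Z4Code.card_codeD hm hh₂ hh]
  refine ⟨?_, Z4Code.ncard_of_weightEnumerator hm3 hP',
    Z4Code.hasMinDistance_of_weightEnumerator hm3 hodd hP',
    Z4Code.distanceInvariant_binaryImage _, Z4Code.distanceInvariant_binaryImage _,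
    fun F _ _ hF => ?_, hP, hP'⟩
  · rw [Z4Code.length, Fintype.card_fin, Nat.sub_add_cancel Nat.one_le_two_pow, pow_succ, mul_two]
  · have : Fact (Nat.Prime 2) := ⟨Nat.prime_two⟩
    have := charP_of_card_eq_prime_pow hF
    rw [hP', Z4Code.weightEnumerator_preparataCode hodd hF]
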